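/- Let $V=\{1,\dots,n\}$ ($n\ge 1$) be a set of agents joined by undirected strong links and undirected weak links such that the graph of all (strong and weak) links is connected. Let $\lambda,\gamma,\phi,\epsilon>0$ and $\tau\ge 0$. Agents choose actions in $\{0,1\}$ in continuous time; at every time one of the actions is better, that is, its material payoff exceeds that of the other by $1$. The payoff of agent $i$ from an action is its material payoff plus $\tau$ times the number of strong neighbours of $i$ that play it. Independent Poisson clocks drive the system: * At each tick $T_1<T_2<\cdots$ of a clock of rate $\lambda$ (payoff shocks; $T_0=0$) a fair coin determines the better action $A_{k+1}$ on $(T_k,T_{k+1}]$; a fair coin also determines $A_1$ at time $0$. * At each tick of a clock of rate $\gamma$, one link, chosen uniformly among the dormant weak links whose two agents play different actions (if there are any), is activated: both of its agents learn the better action, and the link becomes inactive. * Each weak link has its own clock of rate $\phi$, at whose ticks it becomes dormant if it is inactive. * At each tick of a clock of rate $\epsilon$, a uniformly chosen agent trembles: she takes for an instant the action opposite to hers, which reveals the better action to her and to her strong neighbours. An agent also learns the better action whenever a strong neighbour plays another action than she does. Agents without new information keep their action. Informed agents revise instantaneously, one at a time: an informed agent switches when the other action gives her a strictly higher payoff,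 agents who then see a strong neighbour acting differently are informed as well, and this continues until all informed agents play best responses. Fix any (deterministic) selection $E$ of an equilibrium profile so reached, as a function of the current profile, the better action and the set of agents that receive information. At time $0$ all agents play Action $0$ and all weak links are dormant. Changes at a tick take effect right after it. Let $a_i(t)$ be the action of agent $i$ at time $t$. The Activation Markov Chain has the states $q=(P,R,B)$, where $P\in\{0,1\}^n$ is an action profile, $R\in\{0,1\}$ the better action and $B$ the set of dormant weak links. Its transition probability from $(P,R,B)$ to $(P',R',B')$ is $\tfrac12$ times the probability that, at the end of an epoch (at the next payoff shock) with better action $R'$ that starts from the profile $P$ and the dormant links $B$, the profile is $P'$ and the set of dormant links is $B'$. Let $f(q)=\frac1n\sum_{v\in V}\mathbf 1\{P(v)=R\}$, let $\mathcal S_k=\frac1n\sum_{i\in V}\mathbf 1\{a_i(T_k)=A_k\}$ and let the long-run average welfare be $\mathcal S=\lim_{k\to\infty}\mathbb E[\mathcal S_k]$. Then the Activation Markov Chain has a stationary distribution $\eta$, namely the limit as $k\to\infty$ of the law of the state at time $T_k$; the limit $\mathcal S$ exists, and $$\mathcal S=\sum_q \eta_q f(q).$$ If $\tau d_{\max}<1$,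 where $d_{\max}$ is the largest number of strong links of an agent, then $\eta$ is the only stationary distribution of the chain. -/

import Mathlib

open MeasureTheory ProbabilityTheory Filter Topology

noncomputable section

namespace WeakLinks

/-! ### The society -/

/-- A society of the agents `Fin n`: the undirected graphs of strong and of weak links, the rates of
the Poisson clocks (payoff shocks `lam`, weak-link activation `gam`, return of an inactive weak link
to the dormant state `phi`, trembles `eps`), and the weight `tau` of the network payoff. -/
structure Society (n : ℕ) where
  strong : SimpleGraph (Fin n)
  weak : SimpleGraph (Fin n)
  lam : ℝ
  gam : ℝ
  phi : ℝ
  eps : ℝ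
  tau : ℝ
  lam_pos : 0 < lam
  gam_pos : 0 < gam
  phi_pos : 0 < phi
  eps_pos : 0 < eps
  tau_nonneg : 0 ≤ tau

/-- Action profiles; the actions are `false` (Action 0) and `true` (Action 1). -/
abbrev Profile (n : ℕ) : Type := Fin n → Bool

variable {n : ℕ}

namespace Society

/-- The graph of all links, strong and weak; the society is weakly connected when this graph is
connected. -/
def graph (G : Society n) : SimpleGraph (Fin n) := G.strong ⊔ G.weak

/-- The number of strong links of an agent. -/
def degree (G : Society n) (i : Fin n) : ℕ := (G.strong.neighborSet i).ncard

/-- The weak links, as unordered pairs of agents. -/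
def Link (G : Society n) : Type := {e : Sym2 (Fin n) // e ∈ G.weak.edgeSet}

instance (G : Society n) : DecidableEq G.Link :=
  inferInstanceAs (DecidableEq {e : Sym2 (Fin n) // e ∈ G.weak.edgeSet})

instance (G : Society n) : Finite G.Link :=
  inferInstanceAs (Finite {e : Sym2 (Fin n) // e ∈ G.weak.edgeSet})

instance (G : Society n) : Fintype G.Link := Fintype.ofFinite _

instance (G : Society n) : MeasurableSpace G.Link := ⊤

instance (G : Society n) : DiscreteMeasurableSpace G.Link := ⟨fun _ => trivial⟩

/-! ### Payoffs and equilibrium responses -/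

/-- The payoff of agent `i` from action `x` against the profile `a` when `R` is the better action:
the material payoff (normalised to 1 for the better action and 0 for the other, as only the gap of 1
matters) plus `tau` times the number of strong neighbours that play `x`. -/
def payoff (G : Society n) (R : Bool) (a : Profile n) (i : Fin n) (x : Bool) : ℝ :=
  (if x = R then 1 else 0) + G.tau * ({j | G.strong.Adj i j ∧ a j = x} : Set (Fin n)).ncard

/-- The agents that see a strong neighbour playing another action than their own. -/
def observers (G : Society n) (a : Profile n) : Set (Fin n) :=
  {i | ∃ j, G.strong.Adj i j ∧ a j ≠ a i}

/-- One revision within an instant. In `(a, K)` the agents of `K` have received information, so that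
they know the better action `R` for certain. One of them to whom the other action gives a strictly
higher payoff switches, and the agents that now see a neighbour acting differently are informed as
well. Agents without new information keep their action: all of their strong neighbours play the
same action as they do, and their beliefs have not been reversed since their last information. -/
def Revises (G : Society n) (R : Bool) (s s' : Profile n × Set (Fin n)) : Prop :=
  ∃ i ∈ s.2, G.payoff R s.1 i (s.1 i) < G.payoff R s.1 i (!(s.1 i)) ∧
    s'.1 = Function.update s.1 i (!(s.1 i)) ∧ s'.2 = s.2 ∪ G.observers s'.1

/-- `b` is an equilibrium profile to which the agents may come, within an instant, from the profile
`a` when `R` is the better action and the agents of `J` receive information: it is reached by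
revisions, and in it every informed agent plays a best response. -/
def IsContinuation (G : Society n) (R : Bool) (a : Profile n) (J : Set (Fin n))
    (b : Profile n) : Prop :=
  ∃ K, Relation.ReflTransGen (G.Revises R) (a, J ∪ G.observers a) (b, K) ∧
    ∀ i ∈ K, G.payoff R b i (!(b i)) ≤ G.payoff R b i (b i)

/-- A Bayesian-Nash equilibrium of the society, as a rule that says which equilibrium profile is
played after information arrives. (There may be several if `tau` is large.) -/
structure Equilibrium (G : Society n) where
  respond : Bool → Profile n → Set (Fin n) → Profile n
  isContinuation : ∀ R a J, G.IsContinuation R a J (respond R a J)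

/-- The potential of a profile, which every revision raises. -/
def potential (G : Society n) (R : Bool) (a : Profile n) : ℝ :=
  open Classical in
  (∑ i, if a i = R then (1 : ℝ) else 0) +
    G.tau / 2 * ∑ i, ∑ j, if G.strong.Adj i j ∧ a j = a i then (1 : ℝ) else 0

theorem potential_update (G : Society n) (R : Bool) (a : Profile n) (i : Fin n) :
    G.potential R (Function.update a i (!(a i))) - G.potential R a =
      G.payoff R a i (!(a i)) - G.payoff R a i (a i) := by
  classical
  have hsum : ∀ g : Fin n → Fin n → ℝ, ∑ k, ∑ j, g k j =
      g i i + ∑ j ∈ Finset.univ.erase i, g i j + ∑ k ∈ Finset.univ.erase i, g k i +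
        ∑ k ∈ Finset.univ.erase i, ∑ j ∈ Finset.univ.erase i, g k j := by
    intro g
    have h1 : ∀ k, ∑ j, g k j = g k i + ∑ j ∈ Finset.univ.erase i, g k j := fun k =>
      (Finset.add_sum_erase _ _ (Finset.mem_univ i)).symm
    rw [← Finset.add_sum_erase Finset.univ _ (Finset.mem_univ i)]
    simp only [h1, Finset.sum_add_distrib]
    ring
  have hone : ∀ g : Fin n → ℝ, ∑ k, g k = g i + ∑ k ∈ Finset.univ.erase i, g k := fun g =>
    (Finset.add_sum_erase _ _ (Finset.mem_univ i)).symm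
  have hcard : ∀ x, (({j | G.strong.Adj i j ∧ a j = x} : Set (Fin n)).ncard : ℝ) =
      ∑ j ∈ Finset.univ.erase i, if G.strong.Adj i j ∧ a j = x then (1 : ℝ) else 0 := by
    intro x
    have h := hone fun j => if G.strong.Adj i j ∧ a j = x then (1 : ℝ) else 0
    simp only [SimpleGraph.irrefl, false_and, if_false, zero_add] at h
    rw [← h, Finset.sum_boole, Set.ncard_eq_toFinset_card']
    congr 2
    ext j
    simp
  set a' := Function.update a i (!(a i)) with ha'
  have hi : a' i = !(a i) := by simp [ha']
  have hk : ∀ k ∈ Finset.univ.erase i, a' k = a k := by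
    intro k hk
    simp [ha', Finset.ne_of_mem_erase hk]
  have e1 : ∑ k ∈ Finset.univ.erase i, (if a' k = R then (1 : ℝ) else 0) =
      ∑ k ∈ Finset.univ.erase i, (if a k = R then (1 : ℝ) else 0) :=
    Finset.sum_congr rfl fun k h => by rw [hk k h]
  have e2 : ∑ j ∈ Finset.univ.erase i, (if G.strong.Adj i j ∧ a' j = a' i then (1 : ℝ) else 0) =
      ∑ j ∈ Finset.univ.erase i, (if G.strong.Adj i j ∧ a j = !(a i) then (1 : ℝ) else 0) :=
    Finset.sum_congr rfl fun k h => by rw [hk k h, hi]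
  have e3 : ∑ k ∈ Finset.univ.erase i, (if G.strong.Adj k i ∧ a' i = a' k then (1 : ℝ) else 0) =
      ∑ j ∈ Finset.univ.erase i, (if G.strong.Adj i j ∧ a j = !(a i) then (1 : ℝ) else 0) :=
    Finset.sum_congr rfl fun k h => by
      simp only [hk k h, hi, G.strong.adj_comm k i, eq_comm (a := !(a i)) (b := a k)]
  have e3' : ∑ k ∈ Finset.univ.erase i, (if G.strong.Adj k i ∧ a i = a k then (1 : ℝ) else 0) =
      ∑ j ∈ Finset.univ.erase i, (if G.strong.Adj i j ∧ a j = a i then (1 : ℝ) else 0) :=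
    Finset.sum_congr rfl fun k h => by
      simp only [G.strong.adj_comm k i, eq_comm (a := a i) (b := a k)]
  have e4 : ∑ k ∈ Finset.univ.erase i, ∑ j ∈ Finset.univ.erase i,
        (if G.strong.Adj k j ∧ a' j = a' k then (1 : ℝ) else 0) =
      ∑ k ∈ Finset.univ.erase i, ∑ j ∈ Finset.univ.erase i,
        (if G.strong.Adj k j ∧ a j = a k then (1 : ℝ) else 0) :=
    Finset.sum_congr rfl fun k h => Finset.sum_congr rfl fun j h' => by rw [hk k h, hk j h']
  unfold potential payoff
  rw [hcard, hcard, hsum, hsum, hone, hone fun k => if a k = R then (1 : ℝ) else 0,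
    e1, e2, e3, e3', e4, hi]
  simp only [SimpleGraph.irrefl, false_and, if_false]
  ring

/-- Revisions come to an end, so that an equilibrium exists. -/
theorem exists_isContinuation (G : Society n) (R : Bool) (a : Profile n) (J : Set (Fin n)) :
    ∃ b, G.IsContinuation R a J b := by
  classical
  obtain ⟨s, hs, hmax⟩ := Set.exists_max_image
    {s | Relation.ReflTransGen (G.Revises R) (a, J ∪ G.observers a) s}
    (fun s => G.potential R s.1) (Set.toFinite _) ⟨_, Relation.ReflTransGen.refl⟩
  refine ⟨s.1, s.2, hs, fun i hi => ?_⟩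
  by_contra h
  have hr : G.Revises R s (Function.update s.1 i (!(s.1 i)),
      s.2 ∪ G.observers (Function.update s.1 i (!(s.1 i)))) := ⟨i, hi, not_le.1 h, rfl, rfl⟩
  have h1 := hmax _ (Relation.ReflTransGen.tail hs hr)
  have h2 := G.potential_update R s.1 i
  simp only at h1
  linarith [not_le.1 h]

instance (G : Society n) : Nonempty G.Equilibrium :=
  ⟨⟨fun R a J => (G.exists_isContinuation R a J).choose,
    fun R a J => (G.exists_isContinuation R a J).choose_spec⟩⟩

/-! ### The states -/

/-- A state: the action profile, the better action, the set of dormant weak links. -/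
@[ext] structure State (G : Society n) where
  actions : Profile n
  better : Bool
  dormant : Finset G.Link

/-- States as triples. -/
def State.equivProd (G : Society n) : G.State ≃ Profile n × Bool × Finset G.Link where
  toFun q := (q.actions, q.better, q.dormant)
  invFun t := ⟨t.1, t.2.1, t.2.2⟩
  left_inv _ := rfl
  right_inv _ := rfl

instance (G : Society n) : Fintype G.State := Fintype.ofEquiv _ (State.equivProd G).symm

/-- The fraction of agents that play the better action. -/
def State.fraction {G : Society n} (q : G.State) : ℝ :=
  (1 / (n : ℝ)) * ∑ v : Fin n, if q.actions v = q.better then (1 : ℝ) else 0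

/-- The dormant weak links whose two agents play different actions. -/
def State.eligible {G : Society n} (q : G.State) : Finset G.Link :=
  q.dormant.filter fun e => ∃ i ∈ e.1, ∃ j ∈ e.1, q.actions i ≠ q.actions j

/-! ### The clocks -/

/-- The Poisson clocks: one for payoff shocks, one for weak-link activation, one for trembles, and
one for each weak link, which makes the link dormant again if it is inactive. -/
inductive Clock (G : Society n) : Type
  | shock : Clock G
  | activation : Clock G
  | tremble : Clock G
  | recovery (e : G.Link) : Clock G

instance (G : Society n) : DecidableEq G.Clock := Classical.decEq _

instance (G : Society n) : Nonempty G.Clock := ⟨Clock.shock⟩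

instance (G : Society n) : Finite G.Clock :=
  Finite.of_surjective
    (fun x : Fin 3 ⊕ G.Link => match x with
      | .inl 0 => Clock.shock
      | .inl 1 => Clock.activation
      | .inl 2 => Clock.tremble
      | .inr e => Clock.recovery e)
    (by
      rintro (_ | _ | _ | e)
      · exact ⟨.inl 0, rfl⟩
      · exact ⟨.inl 1, rfl⟩
      · exact ⟨.inl 2, rfl⟩
      · exact ⟨.inr e, rfl⟩)

/-- The rate of each clock. -/
def Clock.rate {G : Society n} : G.Clock → ℝ
  | .shock => G.lam
  | .activation => G.gam
  | .tremble => G.eps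
  | .recovery _ => G.phi

/-- A choice of one link from each nonempty set of weak links. -/
abbrev Choice (G : Society n) : Type :=
  (S : {S : Finset G.Link // S.Nonempty}) → {e : G.Link // e ∈ S.1}

/-- The sample space. A sample consists of the waiting times between the successive ticks of every
clock, the coins that determine the better actions, the agents that tremble, and the choices that
determine which weak links are activated. -/
abbrev Sample (G : Society n) : Type :=
  (G.Clock × ℕ → ℝ) × (ℕ → Bool) × (ℕ → Fin n) × (ℕ → G.Choice)

/-- The link chosen from each nonempty set is uniformly distributed on this set. -/
def choiceLaw (G : Society n) : Measure G.Choice :=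
  Measure.pi fun S =>
    haveI : Nonempty {e : G.Link // e ∈ S.1} := S.2.to_subtype
    (PMF.uniformOfFintype {e : G.Link // e ∈ S.1}).toMeasure

/-- The law of the sample: all of its entries are independent, the waiting times of each clock are
exponential with the rate of this clock, and the other entries are uniform. -/
def law (G : Society n) [NeZero n] : Measure G.Sample :=
  (Measure.infinitePi fun p : G.Clock × ℕ => expMeasure p.1.rate).prod
    ((Measure.infinitePi fun _ : ℕ => (PMF.uniformOfFintype Bool).toMeasure).prod
      ((Measure.infinitePi fun _ : ℕ => (PMF.uniformOfFintype (Fin n)).toMeasure).prod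
        (Measure.infinitePi fun _ : ℕ => G.choiceLaw)))

section Dynamics

variable {G : Society n}

/-- The time of the tick number `k` of a clock, counted from `k = 0`. -/
def tick (ω : G.Sample) (c : G.Clock) (k : ℕ) : ℝ := ∑ j ∈ Finset.range (k + 1), ω.1 (c, j)

/-- The clock that ticks next after each clock `c` has ticked `used c` times. -/
def nextClock (ω : G.Sample) (used : G.Clock → ℕ) : G.Clock :=
  (Finite.exists_min fun c => tick ω c (used c)).choose

/-- How often each clock has ticked when there have been `m` ticks altogether. -/
def used (ω : G.Sample) : ℕ → G.Clock → ℕ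
  | 0 => fun _ => 0
  | m + 1 => Function.update (used ω m) (nextClock ω (used ω m))
      (used ω m (nextClock ω (used ω m)) + 1)

/-- The time of the tick number `m` of all clocks together, counted from `m = 0`. -/
def tickTime (ω : G.Sample) (m : ℕ) : ℝ :=
  tick ω (nextClock ω (used ω m)) (used ω m (nextClock ω (used ω m)))

/-- The state after the tick number `k` of clock `c`.
* At a payoff shock a coin determines the better action.
* At a tick of the activation clock, a uniformly chosen eligible link, if there is one, informs its
  two agents and becomes inactive.
* At a tremble, a uniformly chosen agent takes for an instant the opposite of the action that she
  plays, which reveals the better action to herself and to her strong neighbours.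
* At a tick of the clock of a weak link, this link is dormant afterwards. -/
def react (E : G.Equilibrium) (ω : G.Sample) (c : G.Clock) (k : ℕ) (q : G.State) : G.State :=
  match c with
  | .shock =>
      { q with
        actions := E.respond (ω.2.1 (k + 1)) q.actions ∅
        better := ω.2.1 (k + 1) }
  | .activation =>
      if h : q.eligible.Nonempty then
        let e : G.Link := (ω.2.2.2 k ⟨q.eligible, h⟩).1
        { q with
          actions := E.respond q.better q.actions {i | i ∈ e.1}
          dormant := q.dormant.erase e }
      else q
  | .tremble =>
      { q with
        actions := E.respond q.better q.actions
          (insert (ω.2.2.1 k) (G.strong.neighborSet (ω.2.2.1 k))) }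
  | .recovery e => { q with dormant := insert e q.dormant }

/-- The state at the start of an epoch with better action `R`, if the profile was `P` and the links
in `B` were dormant just before. -/
def start (E : G.Equilibrium) (P : Profile n) (R : Bool) (B : Finset G.Link) : G.State :=
  ⟨E.respond R P ∅, R, B⟩

/-- The state after `m` ticks, if `q` is the state at time 0. -/
def stateAfter (E : G.Equilibrium) (ω : G.Sample) (q : G.State) : ℕ → G.State
  | 0 => q
  | m + 1 => react E ω (nextClock ω (used ω m)) (used ω m (nextClock ω (used ω m)))
      (stateAfter E ω q m)

/-- The state at time `t`, if `q` is the state at time 0. A tick takes effect right after its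
time: the state at time `t` is the one after all ticks before `t`. -/
def stateAt (E : G.Equilibrium) (ω : G.Sample) (q : G.State) (t : ℝ) : G.State :=
  stateAfter E ω q (sInf {m | t ≤ tickTime ω m})

/-- The time `T_k` of the `k`-th payoff shock, with `T_0 = 0`. -/
def shockTime (ω : G.Sample) (k : ℕ) : ℝ := ∑ j ∈ Finset.range k, ω.1 (Clock.shock, j)

/-- The initial state: all agents play Action 0, a coin determines the better action, and all weak
links are dormant. -/
def initial (E : G.Equilibrium) (ω : G.Sample) : G.State :=
  start E (fun _ => false) (ω.2.1 0) Finset.univ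

/-- The state of the society at the time `T_k`. -/
def atShock (E : G.Equilibrium) (k : ℕ) (ω : G.Sample) : G.State :=
  stateAt E ω (initial E ω) (shockTime ω k)

/-- The average welfare `S_k` at the time `T_k`: the fraction of agents with `a_i(T_k) = A_k`. -/
def welfare (E : G.Equilibrium) (k : ℕ) (ω : G.Sample) : ℝ := (atShock E k ω).fraction

/-! ### The activation Markov chain -/

/-- The probability that, at the end of an epoch with better action `R`, the actions are played
according to `P'` and the dormant links are those in `B'`, given that the profile is initialised at
`P` and the links in `B` are dormant. -/
def epochProb [NeZero n] (E : G.Equilibrium) (R : Bool) (P : Profile n) (B : Finset G.Link)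
    (P' : Profile n) (B' : Finset G.Link) : ℝ :=
  G.law.real {ω | (stateAt E ω (start E P R B) (shockTime ω 1)).actions = P' ∧
    (stateAt E ω (start E P R B) (shockTime ω 1)).dormant = B'}

/-- The probability of a transition from `q` to `q'` in the activation Markov chain. -/
def transition [NeZero n] (E : G.Equilibrium) (q q' : G.State) : ℝ :=
  1 / 2 * epochProb E q'.better q.actions q.dormant q'.actions q'.dormant

/-- `η` is a stationary distribution of the activation Markov chain. -/
def IsStationary [NeZero n] (E : G.Equilibrium) (η : G.State → ℝ) : Prop :=
  (∀ q, 0 ≤ η q) ∧ ∑ q, η q = 1 ∧ ∀ q', ∑ q, η q * transition E q q' = η q'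

end Dynamics

end Society

end WeakLinks

end

/-!
At a tick of any clock, the exponential clocks start afresh: the first tick is one of clock `c` with
probability proportional to the rate of `c`, and given this, the remaining waiting times again have
the law of the sample, independently of the coin, agent or link that the tick uses
(`law_startsWith_inter_react`). So the probability of each state at the `k`-th payoff shock, as a
function of the state at time 0, satisfies a first-step equation. Since each tick is a payoff shock
with positive probability, such an equation has only one bounded solution (`eq_of_interim`). The same
argument shows that almost surely each payoff shock comes after finitely many ticks
(`lawReal_neverShock`).

Let `e` be the matrix of an epoch and `Π` that of the change of the better action at a payoff shock.
Uniqueness gives the renewal formula `e (Π e) ^ k` for the law at the shock `k + 1`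
(`coinMatrix_succ`). As the better action does not change within an epoch, `Π e` is the transition
matrix of the activation Markov chain, so the law of the state at the shock `k ≥ 1` is a row of its
`k`-th power (`lawReal_atShock`).

Every transition ends in a state in which nobody revises without new information. From such a state
the chain stays put with positive probability: the same action stays better and the next tick is
already a payoff shock. The powers of a stochastic matrix with a positive diagonal converge
(`exists_tendsto_pow_of_stochastic`), because the matrix is an average of the identity and a
nonexpansive map, so that the increments of its orbits tend to zero by the Goebel–Kirk inequality.
Hence the laws converge, whatever the number of recurrent classes, and the limit is stationary.

If `tau * degree < 1`, informed agents always choose the better action. Then from every state the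
chain moves with positive probability to the state with Action 1 better, played by everyone, and all
weak links dormant: all agents tremble one after another, and then all links recover
(`transition_consensus_pos`). Such a chain has only one stationary distribution
(`stationary_unique`).
-/

noncomputable section

namespace WeakLinks

/-! ### Regeneration of product measures -/

/-- The map `f` regenerates the measure `μ` on the event `A`: on `A`, the image of `μ` under `f` is
`μ` again, scaled by the mass of `A`. For a probability measure and `μ A ≠ 0` this says that `f` has
the law `μ` conditionally on `A`. -/
structure Regenerates {Ω : Type*} [MeasurableSpace Ω] (μ : Measure Ω) (A : Set Ω) (f : Ω → Ω) :
    Prop where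
  measurable : Measurable f
  measurableSet : MeasurableSet A
  measure_inter : ∀ D, MeasurableSet D → μ (A ∩ f ⁻¹' D) = μ A * μ D

namespace Regenerates

variable {Ω Ω' : Type*} [MeasurableSpace Ω] [MeasurableSpace Ω']

theorem univ_id (μ : Measure Ω) [IsProbabilityMeasure μ] : Regenerates μ Set.univ id :=
  ⟨measurable_id, .univ, fun D _ => by simp⟩

theorem map_restrict {μ : Measure Ω} {A : Set Ω} {f : Ω → Ω} (h : Regenerates μ A f) :
    (μ.restrict A).map f = μ A • μ := by
  ext D hD
  rw [Measure.map_apply h.measurable hD, Measure.restrict_apply (h.measurable hD), Set.inter_comm,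
    h.measure_inter D hD, Measure.smul_apply, smul_eq_mul]

theorem of_map_restrict {μ : Measure Ω} {A : Set Ω} {f : Ω → Ω} (hf : Measurable f)
    (hA : MeasurableSet A) (h : (μ.restrict A).map f = μ A • μ) : Regenerates μ A f := by
  refine ⟨hf, hA, fun D hD => ?_⟩
  have := congrArg (fun ν => ν D) h
  simp only [Measure.smul_apply, smul_eq_mul] at this
  rw [← this, Measure.map_apply hf hD, Measure.restrict_apply (hf hD), Set.inter_comm]

theorem prod {μ : Measure Ω} {ν : Measure Ω'} [IsProbabilityMeasure μ] [IsProbabilityMeasure ν]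
    {A : Set Ω} {B : Set Ω'} {f : Ω → Ω} {g : Ω' → Ω'} (h : Regenerates μ A f)
    (h' : Regenerates ν B g) : Regenerates (μ.prod ν) (A ×ˢ B) (Prod.map f g) := by
  refine of_map_restrict (h.measurable.prodMap h'.measurable)
    (h.measurableSet.prod h'.measurableSet) ?_
  rw [← Measure.prod_restrict, ← Measure.map_prod_map _ _ h.measurable h'.measurable,
    h.map_restrict, h'.map_restrict, Measure.prod_smul_left, Measure.prod_smul_right, smul_smul,
    Measure.prod_prod]

theorem infinitePi {ι : Type*} {X : ι → Type*} [∀ i, MeasurableSpace (X i)]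
    {μ : ∀ i, Measure (X i)} [∀ i, IsProbabilityMeasure (μ i)] {A : ∀ i, Set (X i)}
    {f : ∀ i, X i → X i} (F : Finset ι) (h : ∀ i, Regenerates (μ i) (A i) (f i))
    (hF : ∀ i, i ∉ F → A i = Set.univ) :
    Regenerates (Measure.infinitePi μ) (Set.pi F A) (fun x i => f i (x i)) := by
  classical
  have hf : Measurable fun (x : ∀ i, X i) i => f i (x i) :=
    measurable_pi_lambda _ fun i => (h i).measurable.comp (measurable_pi_apply i)
  have hA : MeasurableSet (Set.pi (F : Set ι) A) :=
    .pi F.countable_toSet fun i _ => (h i).measurableSet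
  refine of_map_restrict hf hA ?_
  set a := Measure.infinitePi μ (Set.pi F A) with ha
  by_cases h0 : a = 0
  · rw [h0, Measure.restrict_eq_zero.2 h0, Measure.map_zero, zero_smul]
  have htop : a ≠ ⊤ := measure_ne_top _ _
  have hprod : a = ∏ i ∈ F, μ i (A i) :=
    Measure.infinitePi_pi _ fun i _ => (h i).measurableSet
  suffices H : a⁻¹ • ((Measure.infinitePi μ).restrict (Set.pi F A)).map
      (fun x i => f i (x i)) = Measure.infinitePi μ by
    calc _ = a • a⁻¹ • ((Measure.infinitePi μ).restrict (Set.pi F A)).map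
          (fun x i => f i (x i)) := by rw [smul_smul, ENNReal.mul_inv_cancel h0 htop, one_smul]
      _ = _ := by rw [H]
  refine Measure.eq_infinitePi _ fun s t ht => ?_
  have hbox : MeasurableSet (Set.pi (s : Set ι) t) := .pi s.countable_toSet fun i _ => ht i
  have hset : (fun (x : ∀ i, X i) i => f i (x i)) ⁻¹' (Set.pi s t) ∩ Set.pi F A =
      Set.pi ((s ∪ F : Finset ι) : Set ι) fun i => A i ∩ f i ⁻¹' (if i ∈ s then t i else .univ) := by
    ext x
    simp only [Set.mem_inter_iff, Set.mem_preimage, Set.mem_pi, Finset.mem_coe, Finset.mem_union]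
    constructor
    · rintro ⟨h1, h2⟩ i hi
      constructor
      · by_cases hiF : i ∈ F
        · exact h2 i hiF
        · rw [hF i hiF]; trivial
      · split_ifs with his
        · exact h1 i his
        · trivial
    · intro H
      refine ⟨fun i hi => ?_, fun i hi => (H i (.inr hi)).1⟩
      have := (H i (.inl hi)).2
      rwa [if_pos hi] at this
  have ht' : ∀ i, MeasurableSet (if i ∈ s then t i else Set.univ) := fun i => by
    split_ifs
    exacts [ht i, .univ]
  have hs : ∏ i ∈ s ∪ F, μ i (if i ∈ s then t i else Set.univ) = ∏ i ∈ s, μ i (t i) := by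
    rw [← Finset.prod_subset (Finset.subset_union_left : s ⊆ s ∪ F)]
    · exact Finset.prod_congr rfl fun i hi => by rw [if_pos hi]
    · intro i _ hi
      rw [if_neg hi, measure_univ]
  have hF' : ∏ i ∈ s ∪ F, μ i (A i) = a := by
    rw [hprod, ← Finset.prod_subset (Finset.subset_union_right : F ⊆ s ∪ F)]
    intro i _ hi
    rw [hF i hi, measure_univ]
  rw [Measure.smul_apply, Measure.map_apply hf hbox, Measure.restrict_apply (hf hbox), hset,
    Measure.infinitePi_pi _ fun i _ => (h i).measurableSet.inter ((h i).measurable (ht' i)),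
    Finset.prod_congr rfl fun i _ => (h i).measure_inter _ (ht' i), Finset.prod_mul_distrib, hs,
    hF', smul_eq_mul, ← mul_assoc, ENNReal.inv_mul_cancel h0 htop, one_mul]

end Regenerates

/-- Under a product measure, a coordinate and a reindexed family that omits it are independent. -/
theorem infinitePi_map_coordinate_prod {ι X : Type*} [MeasurableSpace X] (μ : ι → Measure X)
    [∀ i, IsProbabilityMeasure (μ i)] (i₀ : ι) (e : ι → ι) (he : Function.Injective e)
    (hne : ∀ i, e i ≠ i₀) (hμ : ∀ i, μ (e i) = μ i) :
    (Measure.infinitePi μ).map (fun x => (x i₀, x ∘ e)) = (μ i₀).prod (Measure.infinitePi μ) := by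
  classical
  have hup : Measurable fun p : X × (ι → X) => Function.update p.2 i₀ p.1 := by
    refine measurable_pi_lambda _ fun i => ?_
    by_cases h : i = i₀
    · subst h; simpa using measurable_fst
    · simp only [Function.update_of_ne h]
      fun_prop
  have hcomp : Measurable fun x : ι → X => x ∘ e :=
    measurable_pi_lambda _ fun i => measurable_pi_apply (e i)
  -- Resampling the coordinate `i₀` independently does not change the product measure.
  have h1 : ((μ i₀).prod (Measure.infinitePi μ)).map (fun p => Function.update p.2 i₀ p.1) =
      Measure.infinitePi μ := by
    refine Measure.eq_infinitePi _ fun s t ht => ?_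
    have hbox : MeasurableSet (Set.pi (s : Set ι) t) := .pi s.countable_toSet fun i _ => ht i
    have hset : (fun p : X × (ι → X) => Function.update p.2 i₀ p.1) ⁻¹' (Set.pi s t) =
        (if i₀ ∈ s then t i₀ else .univ) ×ˢ Set.pi ((s.erase i₀ : Finset ι) : Set ι) t := by
      ext ⟨x, y⟩
      simp only [Set.mem_preimage, Set.mem_pi, Set.mem_prod, Finset.mem_coe, Finset.mem_erase]
      constructor
      · intro H
        refine ⟨?_, fun i hi => by simpa [Function.update_of_ne hi.1] using H i hi.2⟩
        split_ifs with h
        · simpa using H i₀ h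
        · trivial
      · rintro ⟨H1, H2⟩ i hi
        by_cases h : i = i₀
        · subst h
          rw [if_pos hi] at H1
          simpa using H1
        · simpa [Function.update_of_ne h] using H2 i ⟨h, hi⟩
    rw [Measure.map_apply hup hbox, hset, Measure.prod_prod, Measure.infinitePi_pi _ fun i _ => ht i]
    split_ifs with h
    · rw [Finset.mul_prod_erase s (fun i => μ i (t i)) h]
    · rw [measure_univ, one_mul, Finset.erase_eq_of_notMem h]
  have h2 : (Measure.infinitePi μ).map (fun x => x ∘ e) = Measure.infinitePi μ := by
    refine Measure.eq_infinitePi _ fun s t ht => ?_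
    have hbox : MeasurableSet (Set.pi (s : Set ι) t) := .pi s.countable_toSet fun i _ => ht i
    have hset : (fun x : ι → X => x ∘ e) ⁻¹' (Set.pi s t) =
        Set.pi ((s.map ⟨e, he⟩ : Finset ι) : Set ι) (fun j => ⋂ i, ⋂ (_ : e i = j), t i) := by
      ext x
      simp only [Set.mem_preimage, Set.mem_pi, Function.comp_apply, Finset.mem_coe, Finset.mem_map,
        Function.Embedding.coeFn_mk, Set.mem_iInter, forall_exists_index, and_imp]
      constructor
      · rintro H _ i hi rfl j hj
        rw [he hj]; exact H i hi
      · intro H i hi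
        exact H _ i hi rfl i rfl
    have hinter : ∀ i, (⋂ i', ⋂ (_ : e i' = e i), t i') = t i := by
      intro i
      ext y
      simp only [Set.mem_iInter]
      exact ⟨fun H => H i rfl, fun H j hj => by rwa [he hj]⟩
    rw [Measure.map_apply hcomp hbox, hset, Measure.infinitePi_pi, Finset.prod_map]
    · exact Finset.prod_congr rfl fun i _ => by
        simp only [Function.Embedding.coeFn_mk, hinter, hμ]
    · intro j hj
      obtain ⟨i, _, rfl⟩ := Finset.mem_map.1 hj
      simp only [Function.Embedding.coeFn_mk, hinter]
      exact ht i
  have hmeas : Measurable fun x : ι → X => (x i₀, x ∘ e) := (measurable_pi_apply i₀).prodMk hcomp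
  calc (Measure.infinitePi μ).map (fun x => (x i₀, x ∘ e))
      = (((μ i₀).prod (Measure.infinitePi μ)).map (fun p => Function.update p.2 i₀ p.1)).map
          (fun x => (x i₀, x ∘ e)) := by rw [h1]
    _ = ((μ i₀).prod (Measure.infinitePi μ)).map (Prod.map id fun x => x ∘ e) := by
        rw [Measure.map_map hmeas hup]
        congr 1
        ext p i
        · simp
        · simp [Function.update_of_ne (hne i)]
    _ = (μ i₀).prod (Measure.infinitePi μ) := by
        rw [← Measure.map_prod_map _ _ measurable_id hcomp, h2, Measure.map_id]

/-- Dropping a coordinate regenerates a product measure on each event about this coordinate. -/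
theorem regenerates_drop {ι X : Type*} [MeasurableSpace X] (μ : ι → Measure X)
    [∀ i, IsProbabilityMeasure (μ i)] (i₀ : ι) (e : ι → ι) (he : Function.Injective e)
    (hne : ∀ i, e i ≠ i₀) (hμ : ∀ i, μ (e i) = μ i) {A : Set X} (hA : MeasurableSet A) :
    Regenerates (Measure.infinitePi μ) {x | x i₀ ∈ A} (fun x => x ∘ e) := by
  have hcomp : Measurable fun x : ι → X => x ∘ e :=
    measurable_pi_lambda _ fun i => measurable_pi_apply (e i)
  have hmeas : Measurable fun x : ι → X => (x i₀, x ∘ e) := (measurable_pi_apply i₀).prodMk hcomp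
  refine ⟨hcomp, measurable_pi_apply i₀ hA, fun D hD => ?_⟩
  have h := infinitePi_map_coordinate_prod μ i₀ e he hne hμ
  have h1 := Measure.map_apply (μ := Measure.infinitePi μ) hmeas (hA.prod hD)
  rw [h, Measure.prod_prod] at h1
  have h2 : Measure.infinitePi μ {x | x i₀ ∈ A} = μ i₀ A := by
    conv_rhs => rw [← Measure.infinitePi_map_eval μ i₀, Measure.map_apply (measurable_pi_apply i₀) hA]
    rfl
  rw [h2, h1]
  rfl

/-! ### Exponential races -/

/-- The tail of an exponential law, with the memorylessness in the form of a translation. -/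
theorem expMeasure_Ioi_inter {r x : ℝ} (hx : 0 ≤ x) {D : Set ℝ}
    (hD : MeasurableSet D) :
    expMeasure r (Set.Ioi x ∩ (fun y => y - x) ⁻¹' D) =
      ENNReal.ofReal (Real.exp (-(r * x))) * expMeasure r D := by
  have hm : Measurable (exponentialPDF r) := (measurable_exponentialPDFReal r).ennreal_ofReal
  have hE : expMeasure r = volume.withDensity (exponentialPDF r) := rfl
  have hsub : Measurable fun y : ℝ => y - x := measurable_id.sub_const x
  rw [hE, withDensity_apply _ (measurableSet_Ioi.inter (hsub hD)), withDensity_apply _ hD,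
    ← lintegral_indicator (measurableSet_Ioi.inter (hsub hD)), ← lintegral_indicator hD,
    ← lintegral_const_mul _ (hm.indicator hD), ← lintegral_add_right_eq_self _ x]
  refine lintegral_congr_ae ?_
  have h0 : ∀ᵐ y : ℝ, y ≠ 0 := Measure.ae_ne volume 0
  classical
  filter_upwards [h0] with y hy
  simp only [Set.indicator_apply, Set.mem_inter_iff, Set.mem_Ioi, Set.mem_preimage,
    add_sub_cancel_right, lt_add_iff_pos_left]
  by_cases hyD : y ∈ D
  · rcases lt_or_gt_of_ne hy with h | h
    · simp [hyD, not_lt.2 h.le, exponentialPDF_of_neg h]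
    · simp only [hyD, h, and_self, if_true]
      rw [exponentialPDF_of_nonneg h.le, exponentialPDF_of_nonneg (add_nonneg h.le hx),
        ← ENNReal.ofReal_mul (Real.exp_pos _).le]
      congr 1
      rw [mul_add, neg_add, Real.exp_add]
      ring
  · simp [hyD]

theorem expMeasure_Ioi {r x : ℝ} (hr : 0 < r) (hx : 0 ≤ x) :
    expMeasure r (Set.Ioi x) = ENNReal.ofReal (Real.exp (-(r * x))) := by
  have := isProbabilityMeasure_expMeasure hr
  simpa using expMeasure_Ioi_inter (r := r) hx MeasurableSet.univ

theorem regenerates_expMeasure {r x : ℝ} (hr : 0 < r) (hx : 0 ≤ x) :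
    Regenerates (expMeasure r) (Set.Ioi x) (fun y => y - x) :=
  ⟨measurable_id.sub_const x, measurableSet_Ioi, fun D hD => by
    rw [expMeasure_Ioi_inter hx hD, expMeasure_Ioi hr hx]⟩

theorem expMeasure_ae_pos {r : ℝ} (hr : 0 < r) : ∀ᵐ x ∂expMeasure r, 0 < x := by
  have := isProbabilityMeasure_expMeasure hr
  have h : expMeasure r (Set.Ioi 0) = 1 := by
    rw [expMeasure_Ioi hr le_rfl]
    simp
  exact (prob_compl_eq_zero_iff measurableSet_Ioi).2 h

theorem lintegral_exp_expMeasure {r s : ℝ} (hr : 0 < r) (hs : 0 ≤ s) :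
    ∫⁻ x, ENNReal.ofReal (Real.exp (-(s * x))) ∂expMeasure r = ENNReal.ofReal (r / (r + s)) := by
  have hm : ∀ r, Measurable (exponentialPDF r) := fun r =>
    (measurable_exponentialPDFReal r).ennreal_ofReal
  have hE : expMeasure r = volume.withDensity (exponentialPDF r) := rfl
  have hrs : 0 < r + s := by linarith
  rw [hE, lintegral_withDensity_eq_lintegral_mul _ (hm r) (by fun_prop)]
  calc _ = ∫⁻ x, ENNReal.ofReal (r / (r + s)) * exponentialPDF (r + s) x := by
        refine lintegral_congr fun x => ?_
        rw [Pi.mul_apply]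
        rcases lt_or_ge x 0 with h | h
        · simp [exponentialPDF_of_neg h]
        · rw [exponentialPDF_of_nonneg h, exponentialPDF_of_nonneg h,
            ← ENNReal.ofReal_mul (by positivity), ← ENNReal.ofReal_mul (by positivity)]
          congr 1
          have : Real.exp (-((r + s) * x)) = Real.exp (-(r * x)) * Real.exp (-(s * x)) := by
            rw [← Real.exp_add]; congr 1; ring
          rw [this]
          field_simp
    _ = _ := by
        rw [lintegral_const_mul _ (hm _), lintegral_exponentialPDF_eq_one hrs, mul_one]

section Race

variable {C : Type*}

/-- The event that clock `c` ticks first, strictly before every other clock; `x (c, j)` is the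
waiting time of clock `c` before its tick number `j`. -/
def firstTick (c : C) : Set (C × ℕ → ℝ) := {x | ∀ c', c' ≠ c → x (c, 0) < x (c', 0)}

/-- The waiting times that are left right after the first tick, if this is a tick of clock `c`. -/
def residual [DecidableEq C] (c : C) (x : C × ℕ → ℝ) (p : C × ℕ) : ℝ :=
  if p.1 = c then x (c, p.2 + 1) else if p.2 = 0 then x p - x (c, 0) else x p

theorem measurable_residual [DecidableEq C] (c : C) : Measurable (residual c) := by
  refine measurable_pi_lambda _ fun p => ?_
  unfold residual
  split_ifs <;> fun_prop

theorem measurableSet_firstTick [Countable C] (c : C) : MeasurableSet (firstTick c) := by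
  have : firstTick c = ⋂ c', ⋂ (_ : c' ≠ c), {x : C × ℕ → ℝ | x (c, 0) < x (c', 0)} := by
    ext; simp [firstTick]
  rw [this]
  exact .iInter fun c' => .iInter fun _ =>
    measurableSet_lt (measurable_pi_apply _) (measurable_pi_apply _)

/-- Independent exponential clocks: the first tick is one of clock `c` with a probability
proportional to the rate of `c`, and then the clocks start afresh. -/
theorem measure_firstTick_inter [Fintype C] [DecidableEq C] (r : C → ℝ) (hr : ∀ c, 0 < r c) (c : C) {D : Set (C × ℕ → ℝ)}
    (hD : MeasurableSet D) :
    Measure.infinitePi (fun p : C × ℕ => expMeasure (r p.1)) (firstTick c ∩ residual c ⁻¹' D) =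
      ENNReal.ofReal (r c / ∑ c', r c') *
        Measure.infinitePi (fun p : C × ℕ => expMeasure (r p.1)) D := by
  have hprob : ∀ p : C × ℕ, IsProbabilityMeasure (expMeasure (r p.1)) := fun p =>
    isProbabilityMeasure_expMeasure (hr p.1)
  set μ := Measure.infinitePi (fun p : C × ℕ => expMeasure (r p.1)) with hμdef
  let e : C × ℕ → C × ℕ := fun p => if p.1 = c then (p.1, p.2 + 1) else p
  have he : Function.Injective e := by
    rintro ⟨a, j⟩ ⟨b, k⟩ h
    by_cases ha : a = c <;> by_cases hb : b = c <;> simp_all [e]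
  have hne : ∀ p, e p ≠ (c, 0) := by
    rintro ⟨a, j⟩ h
    by_cases ha : a = c <;> simp_all [e]
  have hfst : ∀ p, expMeasure (r (e p).1) = expMeasure (r p.1) := by
    intro p
    by_cases hp : p.1 = c <;> simp [e, hp]
  have hmap := infinitePi_map_coordinate_prod (fun p : C × ℕ => expMeasure (r p.1)) (c, 0) e he
    hne hfst
  let F : Finset (C × ℕ) := (Finset.univ.erase c).map ⟨fun c' => (c', 0), Prod.mk_left_injective 0⟩
  have hF : ∀ p : C × ℕ, p ∈ F ↔ p.1 ≠ c ∧ p.2 = 0 := by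
    rintro ⟨a, j⟩
    rw [Finset.mem_map]
    constructor
    · rintro ⟨b, hb, h⟩
      obtain ⟨rfl, rfl⟩ := Prod.mk.inj h
      exact ⟨Finset.ne_of_mem_erase hb, rfl⟩
    · rintro ⟨h, h'⟩
      simp only at h'
      subst h'
      exact ⟨a, Finset.mem_erase.2 ⟨h, Finset.mem_univ a⟩, rfl⟩
  let g : ℝ → C × ℕ → ℝ → ℝ := fun x p y => if p ∈ F then y - x else y
  let A : ℝ → C × ℕ → Set ℝ := fun x p => if p ∈ F then Set.Ioi x else Set.univ
  have hmeas : Measurable fun x : C × ℕ → ℝ => (x (c, 0), x ∘ e) :=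
    (measurable_pi_apply _).prodMk (measurable_pi_lambda _ fun i => measurable_pi_apply (e i))
  let T : Set (ℝ × (C × ℕ → ℝ)) := {q | q.2 ∈ Set.pi F (A q.1) ∧ (fun p => g q.1 p (q.2 p)) ∈ D}
  have hT : MeasurableSet T := by
    have hT' : T = {q : ℝ × (C × ℕ → ℝ) | q.2 ∈ Set.pi F (A q.1)} ∩
        (fun q : ℝ × (C × ℕ → ℝ) => fun p => g q.1 p (q.2 p)) ⁻¹' D := rfl
    rw [hT']
    refine MeasurableSet.inter ?_ ?_
    · have : {q : ℝ × (C × ℕ → ℝ) | q.2 ∈ Set.pi F (A q.1)} = ⋂ p ∈ F, {q | q.1 < q.2 p} := by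
        ext q
        simp +contextual [A, Set.mem_pi]
      rw [this]
      exact .biInter F.countable_toSet fun p _ => measurableSet_lt (by fun_prop) (by fun_prop)
    · refine (measurable_pi_lambda _ fun p => ?_) hD
      by_cases hp : p ∈ F <;> simp only [g, hp, if_true, if_false] <;> fun_prop
  have hpre : firstTick c ∩ residual c ⁻¹' D = (fun x : C × ℕ → ℝ => (x (c, 0), x ∘ e)) ⁻¹' T := by
    ext x
    have h1 : x ∈ firstTick c ↔ x ∘ e ∈ Set.pi F (A (x (c, 0))) := by
      simp only [firstTick, Set.mem_ofPred_eq, Set.mem_pi, Finset.mem_coe]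
      constructor
      · rintro h ⟨a, j⟩ hp
        have := (hF _).1 hp
        simp only at this
        obtain ⟨ha, rfl⟩ := this
        simpa [A, hp, e, ha] using h a ha
      · intro h a ha
        have hp : (a, 0) ∈ F := (hF _).2 ⟨ha, rfl⟩
        simpa [A, hp, e, ha] using h (a, 0) hp
    have h2 : residual c x = fun p => g (x (c, 0)) p ((x ∘ e) p) := by
      funext ⟨a, j⟩
      by_cases ha : a = c
      · subst ha
        simp [residual, g, hF, e]
      · by_cases hj : j = 0 <;> simp [residual, g, hF, e, ha, hj]
    simp only [Set.mem_inter_iff, Set.mem_preimage, T, Set.mem_ofPred_eq, h1, h2]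
  have hsec : ∀ x : ℝ, 0 < x → μ (Prod.mk x ⁻¹' T) =
      ENNReal.ofReal (Real.exp (-((∑ c' ∈ Finset.univ.erase c, r c') * x))) * μ D := by
    intro x hx
    have hreg : Regenerates μ (Set.pi F (A x)) (fun z p => g x p (z p)) := by
      refine Regenerates.infinitePi F (fun p => ?_) fun p hp => by simp [A, hp]
      by_cases hp : p ∈ F
      · simpa [A, g, hp] using regenerates_expMeasure (hr p.1) hx.le
      · have := Regenerates.univ_id (expMeasure (r p.1))
        simpa [A, g, hp] using! this
    have hA : μ (Set.pi F (A x)) =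
        ENNReal.ofReal (Real.exp (-((∑ c' ∈ Finset.univ.erase c, r c') * x))) := by
      rw [hμdef, Measure.infinitePi_pi]
      · rw [Finset.prod_congr rfl fun p hp => show _ =
          ENNReal.ofReal (Real.exp (-(r p.1 * x))) by
            simp only [A, hp, if_true]; exact expMeasure_Ioi (hr p.1) hx.le,
          ← ENNReal.ofReal_prod_of_nonneg fun _ _ => (Real.exp_pos _).le, ← Real.exp_sum,
          Finset.sum_map, Finset.sum_mul, Finset.sum_neg_distrib]
        rfl
      · intro p hp
        simp only [A, Finset.mem_coe.1 hp, if_true]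
        exact measurableSet_Ioi
    rw [← hA, ← hreg.measure_inter D hD]
    rfl
  have hpos : ∀ᵐ x ∂expMeasure (r c), μ (Prod.mk x ⁻¹' T) =
      ENNReal.ofReal (Real.exp (-((∑ c' ∈ Finset.univ.erase c, r c') * x))) * μ D := by
    filter_upwards [expMeasure_ae_pos (hr c)] with x hx using hsec x hx
  have hprobμ : IsProbabilityMeasure μ := by rw [hμdef]; infer_instance
  rw [hpre, ← Measure.map_apply hmeas hT, hmap, Measure.prod_apply hT, lintegral_congr_ae hpos,
    lintegral_mul_const _ (by fun_prop),
    lintegral_exp_expMeasure (hr c) (Finset.sum_nonneg fun c' _ => (hr c').le),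
    Finset.add_sum_erase _ _ (Finset.mem_univ c)]

end Race

/-! ### Finite Markov chains -/

section Chain

variable {S : Type*} [Fintype S]

/-- A linear inequality with a strictly substochastic matrix has only the zero solution. -/
theorem eq_zero_of_abs_le_substochastic {F : S → S → ℝ} (hF : ∀ q q', 0 ≤ F q q') {ρ : ℝ}
    (hρ : ρ < 1) (hsum : ∀ q, ∑ q', F q q' ≤ ρ) {v : S → ℝ}
    (hv : ∀ q, |v q| ≤ ∑ q', F q q' * |v q'|) : v = 0 := by
  funext q
  obtain ⟨m, -, hm⟩ := Finset.exists_max_image Finset.univ (fun q => |v q|) ⟨q, Finset.mem_univ q⟩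
  have h1 : |v m| ≤ ρ * |v m| := by
    calc |v m| ≤ ∑ q', F m q' * |v q'| := hv m
      _ ≤ ∑ q', F m q' * |v m| := Finset.sum_le_sum fun q' _ =>
        mul_le_mul_of_nonneg_left (hm q' (Finset.mem_univ q')) (hF m q')
      _ = (∑ q', F m q') * |v m| := (Finset.sum_mul _ _ _).symm
      _ ≤ ρ * |v m| := mul_le_mul_of_nonneg_right (hsum m) (abs_nonneg _)
  have h2 := abs_nonneg (v m)
  have h3 : |v q| ≤ 0 := (hm q (Finset.mem_univ q)).trans (by nlinarith)
  exact abs_nonpos_iff.1 h3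

/-- The Goebel–Kirk inequality for the averaged map `x ↦ (1 - t) x + t T x` of a nonexpansive map
`T`; `y i` stands for `T (x i)`. -/
theorem goebel_kirk {V : Type*} [NormedAddCommGroup V] [NormedSpace ℝ V] {x y : ℕ → V} {t : ℝ}
    (ht0 : 0 ≤ t) (ht1 : t < 1) (hx : ∀ i, x (i + 1) = (1 - t) • x i + t • y i)
    (hy : ∀ i, ‖y (i + 1) - y i‖ ≤ ‖x (i + 1) - x i‖) (k i : ℕ) :
    (1 + k * t) * ‖y i - x i‖ ≤ ‖y (i + k) - x i‖ +
      ((1 - t) ^ k)⁻¹ * (‖y i - x i‖ - ‖y (i + k) - x (i + k)‖) := by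
  have ht : 0 < 1 - t := by linarith
  have hstep : ∀ i, ‖x (i + 1) - x i‖ = t * ‖y i - x i‖ := fun i => by
    rw [hx, show (1 - t) • x i + t • y i - x i = t • (y i - x i) by module, norm_smul,
      Real.norm_of_nonneg ht0]
  have hanti : ∀ i, ‖y (i + 1) - x (i + 1)‖ ≤ ‖y i - x i‖ := fun i => by
    calc ‖y (i + 1) - x (i + 1)‖ = ‖(y (i + 1) - y i) + (1 - t) • (y i - x i)‖ := by
          rw [hx]; congr 1; module
      _ ≤ ‖y (i + 1) - y i‖ + ‖(1 - t) • (y i - x i)‖ := norm_add_le _ _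
      _ ≤ t * ‖y i - x i‖ + (1 - t) * ‖y i - x i‖ := by
          rw [norm_smul, Real.norm_of_nonneg ht.le, ← hstep]
          gcongr
          exact hy i
      _ = ‖y i - x i‖ := by ring
  have hanti' : ∀ i j, ‖y (i + j) - x (i + j)‖ ≤ ‖y i - x i‖ := fun i j => by
    induction j with
    | zero => rfl
    | succ j ih => exact (hanti (i + j)).trans ih
  have hydist : ∀ i j, ‖y (i + j) - y i‖ ≤ j * (t * ‖y i - x i‖) := fun i j => by
    induction j with
    | zero => simp
    | succ j ih =>
      calc ‖y (i + (j + 1)) - y i‖ = ‖(y (i + j + 1) - y (i + j)) + (y (i + j) - y i)‖ := by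
            rw [sub_add_sub_cancel]; rfl
        _ ≤ ‖y (i + j + 1) - y (i + j)‖ + ‖y (i + j) - y i‖ := norm_add_le _ _
        _ ≤ t * ‖y i - x i‖ + j * (t * ‖y i - x i‖) := by
            gcongr
            refine (hy _).trans ?_
            rw [hstep]
            gcongr
            exact hanti' i j
        _ = ((j + 1 : ℕ) : ℝ) * (t * ‖y i - x i‖) := by push_cast; ring
  induction k generalizing i with
  | zero => simp
  | succ k ih =>
    have h1 := ih (i + 1)
    have e : i + 1 + k = i + (k + 1) := by ring
    rw [e] at h1
    have h2 : ‖y (i + (k + 1)) - x (i + 1)‖ ≤ (1 - t) * ‖y (i + (k + 1)) - x i‖ +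
        t * (((k + 1 : ℕ) : ℝ) * (t * ‖y i - x i‖)) := by
      calc ‖y (i + (k + 1)) - x (i + 1)‖
          = ‖(1 - t) • (y (i + (k + 1)) - x i) + t • (y (i + (k + 1)) - y i)‖ := by
            rw [hx]; congr 1; module
        _ ≤ ‖(1 - t) • (y (i + (k + 1)) - x i)‖ + ‖t • (y (i + (k + 1)) - y i)‖ :=
            norm_add_le _ _
        _ ≤ _ := by
            rw [norm_smul, norm_smul, Real.norm_of_nonneg ht.le, Real.norm_of_nonneg ht0]
            gcongr
            exact hydist i (k + 1)
    set d := ‖y i - x i‖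
    set d1 := ‖y (i + 1) - x (i + 1)‖
    set dk := ‖y (i + (k + 1)) - x (i + (k + 1))‖
    set z := ‖y (i + (k + 1)) - x i‖
    have hd : d1 ≤ d := hanti i
    set c := ((1 - t) ^ k)⁻¹ with hc
    have hc1 : 1 + k * t ≤ c := by
      have hpk : 0 < (1 - t) ^ k := pow_pos ht k
      have h3 : 1 + k * t ≤ (1 + t) ^ k := one_add_mul_le_pow (by linarith) k
      have h4 : (1 + t) ^ k * (1 - t) ^ k ≤ 1 := by
        rw [← mul_pow]
        exact pow_le_one₀ (by nlinarith) (by nlinarith)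
      rw [hc, inv_eq_one_div, le_div_iff₀ hpk]
      exact (mul_le_mul_of_nonneg_right h3 hpk.le).trans h4
    have hc' : ((1 - t) ^ (k + 1))⁻¹ = c * (1 - t)⁻¹ := by rw [pow_succ, mul_inv]
    rw [hc']
    have hfin : (1 - t) * ((1 + ((k + 1 : ℕ) : ℝ) * t) * d) ≤
        (1 - t) * (z + c * (1 - t)⁻¹ * (d - dk)) := by
      have : (1 - t) * (z + c * (1 - t)⁻¹ * (d - dk)) = (1 - t) * z + c * (d - dk) := by
        field_simp
      rw [this]
      push_cast at h2 ⊢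
      nlinarith [mul_le_mul_of_nonneg_right hc1 (sub_nonneg.2 hd)]
    exact le_of_mul_le_mul_left hfin ht

/-- Averaged nonexpansive maps are asymptotically regular on bounded orbits. -/
theorem tendsto_norm_sub_of_averaged {V : Type*} [NormedAddCommGroup V] [NormedSpace ℝ V]
    {x y : ℕ → V} {t B : ℝ} (ht0 : 0 < t) (ht1 : t < 1)
    (hx : ∀ i, x (i + 1) = (1 - t) • x i + t • y i)
    (hy : ∀ i, ‖y (i + 1) - y i‖ ≤ ‖x (i + 1) - x i‖) (hB : ∀ i j, ‖y j - x i‖ ≤ B) :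
    Tendsto (fun i => y i - x i) atTop (𝓝 0) := by
  have hanti : Antitone fun i => ‖y i - x i‖ := by
    refine antitone_nat_of_succ_le fun i => ?_
    have h := hy i
    have e : x (i + 1) - x i = t • (y i - x i) := by rw [hx]; module
    rw [e, norm_smul, Real.norm_of_nonneg ht0.le] at h
    calc ‖y (i + 1) - x (i + 1)‖ = ‖(y (i + 1) - y i) + (1 - t) • (y i - x i)‖ := by
          rw [hx]; congr 1; module
      _ ≤ ‖y (i + 1) - y i‖ + ‖(1 - t) • (y i - x i)‖ := norm_add_le _ _
      _ ≤ t * ‖y i - x i‖ + (1 - t) * ‖y i - x i‖ := by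
          rw [norm_smul, Real.norm_of_nonneg (sub_pos.2 ht1).le]
          gcongr
      _ = ‖y i - x i‖ := by ring
  obtain ⟨d, hd⟩ : ∃ d, Tendsto (fun i => ‖y i - x i‖) atTop (𝓝 d) :=
    ⟨_, tendsto_atTop_ciInf hanti ⟨0, by rintro _ ⟨i, rfl⟩; exact norm_nonneg _⟩⟩
  have hd0 : 0 ≤ d := ge_of_tendsto' hd fun i => norm_nonneg _
  have hk : ∀ k : ℕ, (1 + k * t) * d ≤ B := by
    intro k
    have hlim : Tendsto (fun i => B + ((1 - t) ^ k)⁻¹ *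
        (‖y i - x i‖ - ‖y (i + k) - x (i + k)‖)) atTop
        (𝓝 (B + ((1 - t) ^ k)⁻¹ * (d - d))) :=
      ((hd.sub ((tendsto_add_atTop_iff_nat k).2 hd)).const_mul _).const_add B
    rw [sub_self, mul_zero, add_zero] at hlim
    refine le_of_tendsto_of_tendsto' (hd.const_mul (1 + k * t)) hlim fun i => ?_
    exact (goebel_kirk ht0.le ht1 hx hy k i).trans (add_le_add_left (hB i (i + k)) _)
  have hzero : d = 0 := by
    by_contra hne
    have hpos : 0 < t * d := mul_pos ht0 (lt_of_le_of_ne hd0 (Ne.symm hne))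
    obtain ⟨k, hk'⟩ := exists_nat_gt (B / (t * d))
    rw [div_lt_iff₀ hpos] at hk'
    have := hk k
    nlinarith
  rw [hzero] at hd
  exact tendsto_zero_iff_norm_tendsto_zero.2 hd

/-- If the increments of all orbits of a linear map on a finite-dimensional space tend to zero, then
all orbits converge: the space is the direct sum of the fixed vectors and the increments. -/
theorem exists_tendsto_pow_of_tendsto_increments {V : Type*} [NormedAddCommGroup V]
    [NormedSpace ℝ V] [FiniteDimensional ℝ V] (T : Module.End ℝ V)
    (hT : ∀ f, Tendsto (fun k => (T ^ k) (T f - f)) atTop (𝓝 0)) (f : V) :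
    ∃ g, Tendsto (fun k => (T ^ k) f) atTop (𝓝 g) := by
  have hfix : ∀ a, T a = a → ∀ k, (T ^ k) a = a := by
    intro a ha k
    induction k with
    | zero => rfl
    | succ k ih => rw [pow_succ, Module.End.mul_apply, ha, ih]
  have hdisj : Disjoint (LinearMap.ker (T - 1)) (LinearMap.range (T - 1)) := by
    rw [Submodule.disjoint_def]
    rintro _ hx ⟨h, rfl⟩
    have hx' : T (T h - h) = T h - h := sub_eq_zero.1 hx
    refine tendsto_nhds_unique ?_ (hT h)
    simp only [hfix _ hx']
    exact tendsto_const_nhds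
  have hcompl : IsCompl (LinearMap.ker (T - 1)) (LinearMap.range (T - 1)) := by
    refine (Submodule.isCompl_iff_disjoint _ _ ?_).2 hdisj
    rw [add_comm, LinearMap.finrank_range_add_finrank_ker]
  have hf : f ∈ LinearMap.ker (T - 1) ⊔ LinearMap.range (T - 1) := by
    rw [hcompl.sup_eq_top]
    trivial
  obtain ⟨a, ha, _, ⟨h, rfl⟩, rfl⟩ := Submodule.mem_sup.1 hf
  refine ⟨a, ?_⟩
  have ha' : T a = a := sub_eq_zero.1 ha
  have := (hT h).const_add a
  rw [add_zero] at this
  simp only [map_add, hfix a ha']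
  exact this

theorem norm_mulVec_le_of_stochastic {M : Matrix S S ℝ} (h0 : ∀ q q', 0 ≤ M q q')
    (h1 : ∀ q, ∑ q', M q q' = 1) (f : S → ℝ) : ‖M.mulVec f‖ ≤ ‖f‖ := by
  refine (pi_norm_le_iff_of_nonneg (norm_nonneg f)).2 fun q => ?_
  calc ‖M.mulVec f q‖ ≤ ∑ q', ‖M q q' * f q'‖ := norm_sum_le _ _
    _ ≤ ∑ q', M q q' * ‖f‖ := Finset.sum_le_sum fun q' _ => by
        rw [norm_mul, Real.norm_of_nonneg (h0 q q')]
        exact mul_le_mul_of_nonneg_left (norm_le_pi_norm f q') (h0 q q')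
    _ = ‖f‖ := by rw [← Finset.sum_mul, h1, one_mul]

variable [DecidableEq S]

/-- The powers of a stochastic matrix with a positive diagonal converge. -/
theorem exists_tendsto_pow_of_stochastic {M : Matrix S S ℝ} (h0 : ∀ q q', 0 ≤ M q q')
    (h1 : ∀ q, ∑ q', M q q' = 1) (hdiag : ∀ q, 0 < M q q) (q q' : S) :
    ∃ l, Tendsto (fun k => (M ^ k) q q') atTop (𝓝 l) := by
  -- `M` is an average of the identity and another stochastic matrix `Q`.
  obtain ⟨t, ht0, ht1, ht⟩ : ∃ t : ℝ, 0 < t ∧ t < 1 ∧ ∀ q, 1 - t ≤ M q q := by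
    obtain ⟨m, -, hm⟩ := Finset.exists_min_image Finset.univ (fun q => M q q)
      ⟨q, Finset.mem_univ q⟩
    refine ⟨1 - min (M m m) (1 / 2), ?_, ?_, fun q => ?_⟩
    · linarith [min_le_right (M m m) (1 / 2)]
    · linarith [lt_min (hdiag m) one_half_pos]
    · linarith [min_le_left (M m m) (1 / 2), hm q (Finset.mem_univ q)]
  set Q : Matrix S S ℝ := t⁻¹ • (M - (1 - t) • 1) with hQ
  have hMQ : M = (1 - t) • 1 + t • Q := by
    rw [hQ, smul_smul, mul_inv_cancel₀ ht0.ne', one_smul]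
    abel
  have hQ0 : ∀ q q', 0 ≤ Q q q' := by
    intro a b
    simp only [hQ, Matrix.smul_apply, Matrix.sub_apply, smul_eq_mul]
    refine mul_nonneg (inv_pos.2 ht0).le ?_
    by_cases hab : a = b
    · subst hab
      simpa using ht a
    · simpa [Matrix.one_apply_ne hab] using h0 a b
  have hQ1 : ∀ q, ∑ q', Q q q' = 1 := by
    intro a
    simp only [hQ, Matrix.smul_apply, Matrix.sub_apply, smul_eq_mul, ← Finset.mul_sum,
      Finset.sum_sub_distrib, h1, Matrix.one_apply, Finset.sum_ite_eq, Finset.mem_univ, if_true]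
    field_simp
    ring
  have hTpow : ∀ (k : ℕ) (f : S → ℝ), (Matrix.toLin' M ^ k) f = (M ^ k).mulVec f := by
    intro k f
    rw [← Matrix.toLin'_pow, Matrix.toLin'_apply]
  have hincr : ∀ f, Tendsto (fun k => (Matrix.toLin' M ^ k) (Matrix.toLin' M f - f)) atTop
      (𝓝 0) := by
    intro f
    set x : ℕ → S → ℝ := fun k => (M ^ k).mulVec f with hxdef
    have hxs : ∀ i, x (i + 1) = M.mulVec (x i) := fun i => by
      simp only [hxdef, pow_succ', Matrix.mulVec_mulVec]
    have hxb : ∀ i, ‖x i‖ ≤ ‖f‖ := by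
      intro i
      induction i with
      | zero => simp [hxdef]
      | succ i ih =>
        rw [hxs]
        exact (norm_mulVec_le_of_stochastic h0 h1 _).trans ih
    have hav : ∀ i, x (i + 1) = (1 - t) • x i + t • Q.mulVec (x i) := fun i => by
      rw [hxs]
      conv_lhs => rw [hMQ]
      rw [Matrix.add_mulVec, Matrix.smul_mulVec, Matrix.smul_mulVec, Matrix.one_mulVec]
    have hlim := tendsto_norm_sub_of_averaged (B := ‖f‖ + ‖f‖) ht0 ht1 hav
      (fun i => by
        rw [← Matrix.mulVec_sub]
        exact norm_mulVec_le_of_stochastic hQ0 hQ1 _)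
      (fun i j => (norm_sub_le _ _).trans (add_le_add
        ((norm_mulVec_le_of_stochastic hQ0 hQ1 _).trans (hxb j)) (hxb i)))
    have hlim' := hlim.const_smul t
    rw [smul_zero] at hlim'
    refine hlim'.congr fun k => ?_
    have hk : (M ^ k).mulVec (M.mulVec f) = x (k + 1) := by
      rw [Matrix.mulVec_mulVec, ← pow_succ]
    rw [hTpow, Matrix.toLin'_apply, Matrix.mulVec_sub, hk, hav]
    change _ = _ - x k
    module
  obtain ⟨g, hg⟩ := exists_tendsto_pow_of_tendsto_increments _ hincr (Pi.single q' 1)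
  refine ⟨g q, ((continuous_apply q).tendsto g |>.comp hg).congr fun k => ?_⟩
  simp [hTpow]

/-- The rows of the powers of a stochastic matrix converge at the states of a closed set on which
the diagonal is positive. -/
theorem exists_tendsto_pow_of_closed {M : Matrix S S ℝ} (h0 : ∀ q q', 0 ≤ M q q')
    (h1 : ∀ q, ∑ q', M q q' = 1) (A : Set S) (hA : ∀ q ∈ A, ∀ q' ∉ A, M q q' = 0)
    (hdiag : ∀ q ∈ A, 0 < M q q) {q : S} (hq : q ∈ A) (q' : S) :
    ∃ l, Tendsto (fun k => (M ^ k) q q') atTop (𝓝 l) := by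
  classical
  -- Making the states outside of `A` absorbing does not change the chain on `A`.
  set M' : Matrix S S ℝ := fun a b => if a ∈ A then M a b else if a = b then 1 else 0 with hM'
  have hpow : ∀ k, ∀ a ∈ A, (M ^ k) a q' = (M' ^ k) a q' := by
    intro k
    induction k with
    | zero => intro a _; rfl
    | succ k ih =>
      intro a ha
      rw [pow_succ', pow_succ', Matrix.mul_apply, Matrix.mul_apply]
      refine Finset.sum_congr rfl fun b _ => ?_
      by_cases hb : b ∈ A
      · rw [ih b hb]
        simp [hM', ha]
      · simp [hM', ha, hA a ha b hb]
  simp only [hpow _ q hq]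
  refine exists_tendsto_pow_of_stochastic (fun a b => ?_) (fun a => ?_) (fun a => ?_) q q'
  · simp only [hM']
    split_ifs
    exacts [h0 a b, zero_le_one, le_rfl]
  · by_cases ha : a ∈ A
    · simp [hM', ha, h1]
    · simp [hM', ha]
  · by_cases ha : a ∈ A
    · simp [hM', ha, hdiag a ha]
    · simp [hM', ha]

/-- A chain that jumps to `s` from everywhere with positive probability has at most one stationary
distribution. -/
theorem stationary_unique {M : Matrix S S ℝ} (h0 : ∀ q q', 0 ≤ M q q')
    (h1 : ∀ q, ∑ q', M q q' = 1) {s : S} (hs : ∀ q, 0 < M q s) {η η' : S → ℝ}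
    (hη : ∑ q, η q = 1) (hη' : ∑ q, η' q = 1) (hst : ∀ q', ∑ q, η q * M q q' = η q')
    (hst' : ∀ q', ∑ q, η' q * M q q' = η' q') : η = η' := by
  obtain ⟨m, -, hm⟩ := Finset.exists_min_image Finset.univ (fun q => M q s) ⟨s, Finset.mem_univ s⟩
  set δ := M m s with hδ
  set d : S → ℝ := fun q => η q - η' q with hd
  have hd0 : ∑ q, d q = 0 := by simp [hd, hη, hη']
  have hdst : ∀ q', d q' = ∑ q, d q * (M q q' - if q' = s then δ else 0) := by
    intro q'
    simp only [mul_sub, Finset.sum_sub_distrib, ← Finset.sum_mul, hd0, zero_mul, sub_zero]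
    simp only [hd, sub_mul, Finset.sum_sub_distrib, hst, hst']
  have hnn : ∀ q q', 0 ≤ M q q' - if q' = s then δ else 0 := by
    intro q q'
    split_ifs with h
    · rw [h]; exact sub_nonneg.2 (hm q (Finset.mem_univ q))
    · simpa using h0 q q'
  have hle : ∑ q', |d q'| ≤ (1 - δ) * ∑ q, |d q| := by
    calc ∑ q', |d q'| ≤ ∑ q', ∑ q, |d q| * (M q q' - if q' = s then δ else 0) :=
          Finset.sum_le_sum fun q' _ => by
            conv_lhs => rw [hdst q']
            refine (Finset.abs_sum_le_sum_abs _ _).trans (Finset.sum_le_sum fun q _ => ?_)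
            rw [abs_mul, abs_of_nonneg (hnn q q')]
      _ = (1 - δ) * ∑ q, |d q| := by
          rw [Finset.sum_comm, Finset.mul_sum]
          refine Finset.sum_congr rfl fun q _ => ?_
          rw [← Finset.mul_sum, Finset.sum_sub_distrib, h1]
          simp [mul_comm]
  have hsum0 : ∑ q, |d q| = 0 :=
    le_antisymm (by nlinarith [hs m]) (Finset.sum_nonneg fun q _ => abs_nonneg _)
  funext q
  have := (Finset.sum_eq_zero_iff_of_nonneg fun q _ => abs_nonneg (d q)).1 hsum0 q (Finset.mem_univ q)
  exact sub_eq_zero.1 (abs_eq_zero.1 this)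

end Chain

namespace Society

variable {n : ℕ} {G : Society n}

/-! ### Measurable and finite structures -/

instance : MeasurableSpace G.State := ⊤

instance : DiscreteMeasurableSpace G.State := ⟨fun _ => trivial⟩

instance : MeasurableSpace G.Clock := ⊤

instance : DiscreteMeasurableSpace G.Clock := ⟨fun _ => trivial⟩

instance : Fintype G.Clock := Fintype.ofFinite _

instance : DecidableEq G.State := Classical.decEq _

theorem Clock.rate_pos (c : G.Clock) : 0 < c.rate := by
  cases c
  exacts [G.lam_pos, G.gam_pos, G.eps_pos, G.phi_pos]

instance (p : G.Clock × ℕ) : IsProbabilityMeasure (expMeasure p.1.rate) :=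
  isProbabilityMeasure_expMeasure p.1.rate_pos

instance : IsProbabilityMeasure G.choiceLaw := by
  unfold choiceLaw
  have : ∀ S : {S : Finset G.Link // S.Nonempty}, IsProbabilityMeasure
      (haveI : Nonempty {e : G.Link // e ∈ S.1} := S.2.to_subtype
      (PMF.uniformOfFintype {e : G.Link // e ∈ S.1}).toMeasure) := fun S => inferInstance
  infer_instance

instance [NeZero n] : IsProbabilityMeasure G.law := by
  unfold law
  infer_instance

/-! ### Measurability of the dynamics -/

theorem measurable_tick (c : G.Clock) (k : ℕ) : Measurable fun ω : G.Sample => tick ω c k := by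
  unfold tick
  fun_prop

theorem nextClock_congr {ω ω' : G.Sample} {u u' : G.Clock → ℕ}
    (h : ∀ c y, tick ω c (u c) ≤ tick ω y (u y) ↔ tick ω' c (u' c) ≤ tick ω' y (u' y)) :
    nextClock ω u = nextClock ω' u' := by
  have : (fun c => ∀ y, tick ω c (u c) ≤ tick ω y (u y)) =
      fun c => ∀ y, tick ω' c (u' c) ≤ tick ω' y (u' y) :=
    funext fun c => propext (forall_congr' fun y => h c y)
  unfold nextClock
  congr 1

theorem nextClock_le (ω : G.Sample) (u : G.Clock → ℕ) (c : G.Clock) :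
    tick ω (nextClock ω u) (u (nextClock ω u)) ≤ tick ω c (u c) :=
  (Finite.exists_min fun c => tick ω c (u c)).choose_spec c

theorem measurable_nextClock (u : G.Clock → ℕ) :
    Measurable fun ω : G.Sample => nextClock ω u := by
  classical
  -- `nextClock` depends on the sample only through finitely many comparisons of times.
  let cmp : G.Sample → G.Clock × G.Clock → Bool := fun ω p =>
    decide (tick ω p.1 (u p.1) ≤ tick ω p.2 (u p.2))
  have hcmp : Measurable cmp := by
    refine measurable_pi_lambda _ fun p => measurable_to_bool ?_
    have : (fun ω => cmp ω p) ⁻¹' {true} =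
        {ω : G.Sample | tick ω p.1 (u p.1) ≤ tick ω p.2 (u p.2)} := by
      ext ω; simp [cmp]
    rw [this]
    exact measurableSet_le (measurable_tick _ _) (measurable_tick _ _)
  have hfac : (fun ω : G.Sample => nextClock ω u).FactorsThrough cmp := by
    intro ω ω' h
    refine nextClock_congr fun c y => ?_
    simpa [cmp] using congrFun h (c, y)
  obtain ⟨g, hg⟩ := (Function.factorsThrough_iff _).1 hfac
  rw [hg]
  exact (Measurable.of_discrete (f := g)).comp hcmp

theorem measurable_used (m : ℕ) : Measurable fun ω : G.Sample => used ω m := by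
  induction m with
  | zero => exact measurable_const
  | succ m ih =>
    have h : Measurable fun p : (G.Clock → ℕ) × G.Sample => Function.update p.1 (nextClock p.2 p.1)
        (p.1 (nextClock p.2 p.1) + 1) := by
      refine measurable_from_prod_countable_right fun u => ?_
      exact (Measurable.of_discrete (f := fun c => Function.update u c (u c + 1))).comp
        (measurable_nextClock u)
    exact h.comp (ih.prodMk measurable_id)

theorem measurable_tickTime (m : ℕ) : Measurable fun ω : G.Sample => tickTime ω m := by
  have h : Measurable fun p : (G.Clock × (G.Clock → ℕ)) × G.Sample => tick p.2 p.1.1 (p.1.2 p.1.1) :=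
    measurable_from_prod_countable_right fun p => measurable_tick p.1 (p.2 p.1)
  have h' : Measurable fun p : (G.Clock → ℕ) × G.Sample => nextClock p.2 p.1 :=
    measurable_from_prod_countable_right fun u => measurable_nextClock u
  exact h.comp (((h'.comp ((measurable_used m).prodMk measurable_id)).prodMk
    (measurable_used m)).prodMk measurable_id)

theorem measurable_react (E : G.Equilibrium) (c : G.Clock) (k : ℕ) (q : G.State) :
    Measurable fun ω : G.Sample => react E ω c k q := by
  cases c with
  | shock =>
    exact (Measurable.of_discrete (f := fun R => start E q.actions R q.dormant)).comp
      (by fun_prop : Measurable fun ω : G.Sample => ω.2.1 (k + 1))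
  | activation =>
    by_cases h : q.eligible.Nonempty
    · simp only [react, h, dif_pos]
      exact (Measurable.of_discrete (f := fun ch : G.Choice =>
        ({ q with
          actions := E.respond q.better q.actions {i | i ∈ (ch ⟨q.eligible, h⟩).1.1}
          dormant := q.dormant.erase (ch ⟨q.eligible, h⟩).1 } : G.State))).comp
        (by fun_prop : Measurable fun ω : G.Sample => ω.2.2.2 k)
    · simp only [react, h, dif_neg, not_false_eq_true]
      exact measurable_const
  | tremble =>
    exact (Measurable.of_discrete (f := fun i : Fin n =>
        ({ q with
          actions := E.respond q.better q.actions (insert i (G.strong.neighborSet i)) } :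
            G.State))).comp
        (by fun_prop : Measurable fun ω : G.Sample => ω.2.2.1 k)
  | recovery e => exact measurable_const

theorem measurable_stateAfter (E : G.Equilibrium) (q : G.State) (m : ℕ) :
    Measurable fun ω : G.Sample => stateAfter E ω q m := by
  induction m with
  | zero => exact measurable_const
  | succ m ih =>
    have h : Measurable fun p : ((G.Clock × (G.Clock → ℕ)) × G.State) × G.Sample =>
        react E p.2 p.1.1.1 (p.1.1.2 p.1.1.1) p.1.2 :=
      measurable_from_prod_countable_right fun p =>
        measurable_react E p.1.1 (p.1.2 p.1.1) p.2
    have h' : Measurable fun p : (G.Clock → ℕ) × G.Sample => nextClock p.2 p.1 :=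
      measurable_from_prod_countable_right fun u => measurable_nextClock u
    exact h.comp ((((h'.comp ((measurable_used m).prodMk measurable_id)).prodMk
      (measurable_used m)).prodMk ih).prodMk measurable_id)

theorem measurable_shockTime (k : ℕ) : Measurable fun ω : G.Sample => shockTime ω k := by
  unfold shockTime
  fun_prop

theorem measurable_nat_sInf {Ω : Type*} [MeasurableSpace Ω] {p : ℕ → Ω → Prop}
    (hp : ∀ m, MeasurableSet {ω | p m ω}) : Measurable fun ω => sInf {m | p m ω} := by
  refine measurable_to_countable' fun j => ?_
  have : (fun ω => sInf {m | p m ω}) ⁻¹' {j} =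
      ({ω | p j ω} ∩ ⋂ i, ⋂ (_ : i < j), {ω | p i ω}ᶜ) ∪
        ({_ω : Ω | j = 0} ∩ ⋂ i, {ω | p i ω}ᶜ) := by
    ext ω
    simp only [Set.mem_preimage, Set.mem_singleton_iff, Set.mem_union, Set.mem_inter_iff,
      Set.mem_ofPred_eq, Set.mem_iInter, Set.mem_compl_iff]
    constructor
    · intro h
      by_cases hne : {m | p m ω}.Nonempty
      · left
        refine ⟨?_, fun i hi => ?_⟩
        · have := Nat.sInf_mem hne
          rwa [h] at this
        · rw [← h] at hi
          exact Nat.notMem_of_lt_sInf hi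
      · right
        rw [Set.not_nonempty_iff_eq_empty] at hne
        refine ⟨by rw [← h, hne]; simp, fun i hi => ?_⟩
        have : i ∈ {m | p m ω} := hi
        rw [hne] at this
        exact this
    · rintro (⟨h1, h2⟩ | ⟨h1, h2⟩)
      · refine le_antisymm (Nat.sInf_le h1) ?_
        by_contra hlt
        exact h2 _ (not_le.1 hlt) (Nat.sInf_mem (s := {m | p m ω}) ⟨j, h1⟩)
      · have : {m | p m ω} = ∅ := Set.eq_empty_of_forall_notMem h2
        rw [this, h1]
        simp
  rw [this]
  refine .union ((hp j).inter (.iInter fun i => .iInter fun _ => (hp i).compl)) ?_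
  exact (MeasurableSet.const _).inter (.iInter fun i => (hp i).compl)

/-- The state at the time of the `k`-th payoff shock, if `q` is the state at time 0. -/
def stateAtShock (E : G.Equilibrium) (k : ℕ) (q : G.State) (ω : G.Sample) : G.State :=
  stateAt E ω q (shockTime ω k)

theorem measurable_stateAtShock (E : G.Equilibrium) (k : ℕ) (q : G.State) :
    Measurable (stateAtShock E k q) := by
  have h : Measurable fun p : ℕ × G.Sample => stateAfter E p.2 q p.1 :=
    measurable_from_prod_countable_right fun m => measurable_stateAfter E q m
  exact h.comp ((measurable_nat_sInf fun m =>
    measurableSet_le (measurable_shockTime k) (measurable_tickTime m)).prodMk measurable_id)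

/-- The event that the `k`-th payoff shock is preceded by infinitely many ticks. -/
def neverShock (G : Society n) (k : ℕ) : Set G.Sample := {ω | ∀ m, tickTime ω m < shockTime ω k}

theorem measurableSet_neverShock (k : ℕ) : MeasurableSet (neverShock G k) := by
  have : neverShock G k = ⋂ m, {ω : G.Sample | tickTime ω m < shockTime ω k} := by
    ext; simp [neverShock]
  rw [this]
  exact .iInter fun m => measurableSet_lt (measurable_tickTime m) (measurable_shockTime k)

/-! ### The sample after the first tick -/

/-- The indices of the coins that are left after a payoff shock: coin 1 has been used. Coin 0, which
only the initial state depends on, is kept. -/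
def skipCoin (j : ℕ) : ℕ := if j = 0 then 0 else j + 1

/-- The sample that drives the society after the first tick, if this is a tick of clock `c`. -/
def afterTick (c : G.Clock) : G.Sample → G.Sample :=
  Prod.map (residual c) (match c with
    | .shock => Prod.map (fun x => x ∘ skipCoin) id
    | .tremble => Prod.map id (Prod.map (fun x => x ∘ Nat.succ) id)
    | .activation => Prod.map id (Prod.map id (fun x => x ∘ Nat.succ))
    | .recovery _ => id)

theorem afterTick_fst (c : G.Clock) (ω : G.Sample) : (afterTick c ω).1 = residual c ω.1 := rfl

theorem afterTick_coin_zero (c : G.Clock) (ω : G.Sample) : (afterTick c ω).2.1 0 = ω.2.1 0 := by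
  cases c <;> rfl

/-- The event that the first tick is one of clock `c`. -/
def startsWith (c : G.Clock) : Set G.Sample := {ω | ω.1 ∈ firstTick c}

/-- The waiting times are positive. -/
def positiveWaits (G : Society n) : Set G.Sample := {ω | ∀ p, 0 < ω.1 p}

section Pathwise

variable {ω : G.Sample} {c : G.Clock}

theorem tick_afterTick (c' : G.Clock) (k : ℕ) :
    tick ω c' (if c' = c then k + 1 else k) = ω.1 (c, 0) + tick (afterTick c ω) c' k := by
  unfold tick
  simp only [afterTick_fst, residual]
  by_cases h : c' = c
  · subst h
    simp only [if_true]
    rw [Finset.sum_range_succ']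
    ring
  · simp only [h, if_false]
    rw [Finset.sum_range_succ', Finset.sum_range_succ']
    simp only [Nat.add_eq_zero_iff, one_ne_zero, and_false, if_false, if_true]
    ring

theorem tick_update_afterTick (u : G.Clock → ℕ) (c' : G.Clock) :
    tick ω c' (Function.update u c (u c + 1) c') =
      ω.1 (c, 0) + tick (afterTick c ω) c' (u c') := by
  rw [← tick_afterTick]
  congr 1
  by_cases h : c' = c
  · subst h; simp
  · simp [h]

theorem nextClock_afterTick (u : G.Clock → ℕ) :
    nextClock ω (Function.update u c (u c + 1)) = nextClock (afterTick c ω) u := by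
  refine nextClock_congr fun a b => ?_
  rw [tick_update_afterTick, tick_update_afterTick, add_le_add_iff_left]

theorem nextClock_zero (h : ω ∈ startsWith c) : nextClock ω (fun _ => 0) = c := by
  by_contra hne
  have h1 := nextClock_le ω (fun _ => 0) c
  have h2 := h _ hne
  simp only [tick, zero_add, Finset.sum_range_one] at h1
  linarith

theorem used_succ (h : ω ∈ startsWith c) (m : ℕ) :
    used ω (m + 1) = Function.update (used (afterTick c ω) m) c (used (afterTick c ω) m c + 1) := by
  induction m with
  | zero =>
    change Function.update (fun _ => 0) (nextClock ω fun _ => 0) (0 + 1) = _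
    rw [nextClock_zero h]
    rfl
  | succ m ih =>
    rw [used, ih, nextClock_afterTick]
    set v := used (afterTick c ω) m with hv
    have hs : used (afterTick c ω) (m + 1) = Function.update v (nextClock (afterTick c ω) v)
      (v (nextClock (afterTick c ω) v) + 1) := rfl
    rw [hs]
    generalize nextClock (afterTick c ω) v = d
    funext a
    by_cases hd : d = c
    · subst hd
      by_cases ha : a = d <;> simp [ha]
    · by_cases ha : a = c
      · subst ha
        simp [Ne.symm hd]
      · by_cases had : a = d
        · subst had
          simp [ha]
        · simp [ha, had]

theorem tickTime_zero (h : ω ∈ startsWith c) : tickTime ω 0 = ω.1 (c, 0) := by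
  simp [tickTime, used, nextClock_zero h, tick]

theorem tickTime_succ (h : ω ∈ startsWith c) (m : ℕ) :
    tickTime ω (m + 1) = ω.1 (c, 0) + tickTime (afterTick c ω) m := by
  unfold tickTime
  rw [used_succ h, nextClock_afterTick, tick_update_afterTick]

theorem react_afterTick (E : G.Equilibrium) (c' : G.Clock) (k : ℕ) (q : G.State) :
    react E ω c' (if c' = c then k + 1 else k) q = react E (afterTick c ω) c' k q := by
  by_cases h : c' = c
  · subst h
    cases c' <;> simp [react, afterTick, skipCoin]
  · cases c' <;> cases c <;> simp_all [react, afterTick]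

theorem stateAfter_succ (h : ω ∈ startsWith c) (E : G.Equilibrium) (q : G.State) (m : ℕ) :
    stateAfter E ω q (m + 1) = stateAfter E (afterTick c ω) (react E ω c 0 q) m := by
  induction m with
  | zero =>
    simp only [stateAfter, used, nextClock_zero h]
  | succ m ih =>
    rw [stateAfter, ih, used_succ h, nextClock_afterTick]
    set v := used (afterTick c ω) m with hv
    rw [stateAfter, ← react_afterTick (c := c)]
    congr 1
    rw [Function.update_apply]
    split_ifs with hd
    · rw [← hv, hd]
    · rfl

theorem shockTime_afterTick_of_ne (h : c ≠ .shock) (k : ℕ) :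
    shockTime ω (k + 1) = ω.1 (c, 0) + shockTime (afterTick c ω) (k + 1) := by
  have := tick_afterTick (ω := ω) (c := c) .shock k
  rwa [if_neg h.symm] at this

theorem shockTime_afterTick_shock (k : ℕ) :
    shockTime ω (k + 1) = ω.1 (.shock, 0) + shockTime (afterTick .shock ω) k := by
  unfold shockTime
  rw [Finset.sum_range_succ']
  simp only [afterTick_fst, residual, if_true]
  ring

theorem afterTick_mem_positiveWaits (h : ω ∈ startsWith c) (hpos : ω ∈ positiveWaits G) :
    afterTick c ω ∈ positiveWaits G := by
  rintro ⟨a, j⟩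
  rw [afterTick_fst]
  unfold residual
  split_ifs with h1 h2
  · exact hpos _
  · simp only at h1 h2
    subst h2
    exact sub_pos.2 (h a h1)
  · exact hpos _

theorem tickTime_pos (hpos : ω ∈ positiveWaits G) (m : ℕ) : 0 < tickTime ω m := by
  unfold tickTime tick
  exact Finset.sum_pos (fun _ _ => hpos _) (by simp)

theorem notMem_neverShock_zero (hpos : ω ∈ positiveWaits G) : ω ∉ neverShock G 0 := fun h => by
  have := h 0
  have h0 := tickTime_pos hpos 0
  simp [shockTime] at this
  linarith

/-- If some tick precedes time `t`, the dynamics can be restarted after the first tick. -/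
theorem stateAt_afterTick (h : ω ∈ startsWith c) (E : G.Equilibrium) (q : G.State) {t s : ℝ}
    (ht : t = ω.1 (c, 0) + s) (hs : 0 < s) (hne : ∃ m, t ≤ tickTime ω m) :
    stateAt E ω q t = stateAt E (afterTick c ω) (react E ω c 0 q) s := by
  have hset : ∀ m, s ≤ tickTime (afterTick c ω) m ↔ t ≤ tickTime ω (m + 1) := fun m => by
    rw [tickTime_succ h, ht, add_le_add_iff_left]
  unfold stateAt
  have h0 : ¬ t ≤ tickTime ω 0 := by
    rw [tickTime_zero h, ht]
    linarith
  have key : sInf {m | t ≤ tickTime ω m} = sInf {m | s ≤ tickTime (afterTick c ω) m} + 1 := by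
    have hpos : 0 < sInf {m | t ≤ tickTime ω m} := by
      rcases Nat.eq_zero_or_pos (sInf {m | t ≤ tickTime ω m}) with h' | h'
      · have := Nat.sInf_mem (s := {m | t ≤ tickTime ω m}) hne
        rw [h'] at this
        exact absurd this h0
      · exact h'
    simp only [hset]
    exact (Nat.sInf_add (n := 1) (p := fun m => t ≤ tickTime ω m) hpos).symm
  rw [key, stateAfter_succ h]

theorem mem_neverShock_afterTick_of_ne (h : ω ∈ startsWith c) (hc : c ≠ .shock) (k : ℕ)
    (hω : ω ∈ neverShock G (k + 1)) : afterTick c ω ∈ neverShock G (k + 1) := fun m => by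
  have := hω (m + 1)
  rw [tickTime_succ h, shockTime_afterTick_of_ne hc] at this
  linarith

theorem mem_neverShock_afterTick_shock (h : ω ∈ startsWith .shock) (k : ℕ)
    (hω : ω ∈ neverShock G (k + 1)) : afterTick .shock ω ∈ neverShock G k := fun m => by
  have := hω (m + 1)
  rw [tickTime_succ h, shockTime_afterTick_shock] at this
  linarith

theorem shockTime_pos (hpos : ω ∈ positiveWaits G) (k : ℕ) : 0 < shockTime ω (k + 1) :=
  Finset.sum_pos (fun _ _ => hpos _) (by simp)

theorem stateAtShock_of_ne (h : ω ∈ startsWith c) (hpos : ω ∈ positiveWaits G) (hc : c ≠ .shock)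
    (E : G.Equilibrium) (q : G.State) (k : ℕ) (hω : ω ∉ neverShock G (k + 1)) :
    stateAtShock E (k + 1) q ω =
      stateAtShock E (k + 1) (react E ω c 0 q) (afterTick c ω) := by
  refine stateAt_afterTick h E q (shockTime_afterTick_of_ne hc k)
    (shockTime_pos (afterTick_mem_positiveWaits h hpos) k) ?_
  simpa [neverShock] using hω

theorem stateAtShock_one_shock (h : ω ∈ startsWith .shock) (E : G.Equilibrium) (q : G.State) :
    stateAtShock E 1 q ω = q := by
  have : sInf {m | shockTime ω 1 ≤ tickTime ω m} = 0 := by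
    refine Nat.sInf_eq_zero.2 (.inl ?_)
    simp [tickTime_zero h, shockTime]
  rw [stateAtShock, stateAt, this]
  rfl

theorem stateAtShock_shock (h : ω ∈ startsWith .shock) (hpos : ω ∈ positiveWaits G)
    (E : G.Equilibrium) (q : G.State) (k : ℕ) (hω : ω ∉ neverShock G (k + 2)) :
    stateAtShock E (k + 2) q ω =
      stateAtShock E (k + 1) (react E ω .shock 0 q) (afterTick .shock ω) := by
  refine stateAt_afterTick h E q (shockTime_afterTick_shock (k + 1))
    (shockTime_pos (afterTick_mem_positiveWaits h hpos) k) ?_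
  simpa [neverShock] using hω

end Pathwise

/-! ### The first tick regenerates the law of the sample -/

/-- The probability that the next tick is one of clock `c`. -/
def tickProb (c : G.Clock) : ℝ := c.rate / ∑ c' : G.Clock, c'.rate

theorem sum_rate_pos (G : Society n) : 0 < ∑ c' : G.Clock, c'.rate :=
  Finset.sum_pos (fun c _ => c.rate_pos) Finset.univ_nonempty

theorem tickProb_pos (c : G.Clock) : 0 < tickProb c := div_pos c.rate_pos G.sum_rate_pos

theorem sum_tickProb (G : Society n) : ∑ c : G.Clock, tickProb c = 1 := by
  unfold tickProb
  rw [← Finset.sum_div, div_self G.sum_rate_pos.ne']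

theorem measurableSet_react (E : G.Equilibrium) (c : G.Clock) (k : ℕ) (q q' : G.State) :
    MeasurableSet {ω : G.Sample | react E ω c k q = q'} :=
  measurable_react E c k q (measurableSet_singleton q')

theorem measurableSet_startsWith (c : G.Clock) : MeasurableSet (startsWith c) :=
  measurable_fst (measurableSet_firstTick c)

theorem measurable_afterTick (c : G.Clock) : Measurable (afterTick c) := by
  refine (measurable_residual c).prodMap ?_
  cases c <;> fun_prop

theorem disjoint_startsWith {c c' : G.Clock} (h : c ≠ c') :
    Disjoint (startsWith c) (startsWith c') :=
  Set.disjoint_left.2 fun _ h1 h2 => lt_asymm (h1 c' h.symm) (h2 c h)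

theorem measurableSet_coin_zero (R : Bool) : MeasurableSet {ω : G.Sample | ω.2.1 0 = R} :=
  (by fun_prop : Measurable fun ω : G.Sample => ω.2.1 0) (measurableSet_singleton R)

theorem measurableSet_coinHit (E : G.Equilibrium) (k : ℕ) (R : Bool) (q q' : G.State) :
    MeasurableSet {ω : G.Sample | ω.2.1 0 = R ∧ stateAtShock E k q ω = q'} :=
  (measurableSet_coin_zero R).inter (measurable_stateAtShock E k q (measurableSet_singleton q'))

section

variable [NeZero n]

/-- The probability that a tick of clock `c` leads from the state `q` to the state `q'`. -/
def stepProb (E : G.Equilibrium) (c : G.Clock) (q q' : G.State) : ℝ :=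
  G.law.real {ω | react E ω c 0 q = q'}

/-- The state that a first tick of clock `c` leads to and the sample after this tick are
independent, and the latter has the law of the original sample. -/
theorem law_startsWith_inter_react (E : G.Equilibrium) (c : G.Clock) (q q' : G.State)
    {D : Set G.Sample} (hD : MeasurableSet D) :
    G.law (startsWith c ∩ {ω | react E ω c 0 q = q'} ∩ afterTick c ⁻¹' D) =
      ENNReal.ofReal (tickProb c) * G.law {ω | react E ω c 0 q = q'} * G.law D := by
  set μ := Measure.infinitePi fun p : G.Clock × ℕ => expMeasure p.1.rate with hμ
  set ν := (Measure.infinitePi fun _ : ℕ => (PMF.uniformOfFintype Bool).toMeasure).prod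
      ((Measure.infinitePi fun _ : ℕ => (PMF.uniformOfFintype (Fin n)).toMeasure).prod
        (Measure.infinitePi fun _ : ℕ => G.choiceLaw)) with hν
  have hlaw : G.law = μ.prod ν := rfl
  have hrace : Regenerates μ (firstTick c) (residual c) := by
    refine ⟨measurable_residual c, measurableSet_firstTick c, fun D hD => ?_⟩
    have h := measure_firstTick_inter (C := G.Clock) Clock.rate Clock.rate_pos c .univ
    rw [Set.preimage_univ, Set.inter_univ, measure_univ, mul_one] at h
    rw [hμ, measure_firstTick_inter Clock.rate Clock.rate_pos c hD, h]
  have hfirst : μ (firstTick c) = ENNReal.ofReal (tickProb c) := by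
    have h := measure_firstTick_inter (C := G.Clock) Clock.rate Clock.rate_pos c .univ
    rwa [Set.preimage_univ, Set.inter_univ, measure_univ, mul_one] at h
  suffices H : ∃ B g, Regenerates ν B g ∧ afterTick c = Prod.map (residual c) g ∧
      {ω : G.Sample | react E ω c 0 q = q'} = Set.univ ×ˢ B by
    obtain ⟨B, g, hreg, hg, hB⟩ := H
    have hset : startsWith c ∩ {ω : G.Sample | react E ω c 0 q = q'} = firstTick c ×ˢ B := by
      rw [hB]
      ext ω
      simp [startsWith]
    rw [hset, hg, hlaw, (hrace.prod hreg).measure_inter D hD, Measure.prod_prod, hfirst, hB,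
      Measure.prod_prod, measure_univ, one_mul]
  have hsucc : Function.Injective Nat.succ := Nat.succ_injective
  have hskip : Function.Injective skipCoin := by
    intro a b h
    unfold skipCoin at h
    split_ifs at h <;> omega
  have hskip1 : ∀ i, skipCoin i ≠ 1 := by
    intro i
    unfold skipCoin
    split_ifs <;> omega
  cases c with
  | shock =>
    refine ⟨_, _, (regenerates_drop (fun _ => (PMF.uniformOfFintype Bool).toMeasure) 1 skipCoin hskip
      hskip1 (fun _ => rfl) (A := {R | start E q.actions R q.dormant = q'}) .of_discrete).prod
      (.univ_id _), rfl, ?_⟩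
    ext ω
    simp [react, start]
  | activation =>
    refine ⟨_, _, (Regenerates.univ_id _).prod ((Regenerates.univ_id _).prod
      (regenerates_drop (fun _ => G.choiceLaw) 0 Nat.succ hsucc Nat.succ_ne_zero (fun _ => rfl)
        (A := {ch | (if h : q.eligible.Nonempty then
          ({ q with
            actions := E.respond q.better q.actions {i | i ∈ (ch ⟨q.eligible, h⟩).1.1}
            dormant := q.dormant.erase (ch ⟨q.eligible, h⟩).1 } : G.State)
          else q) = q'}) .of_discrete)), rfl, ?_⟩
    ext ω
    simp [react]
  | tremble =>
    refine ⟨_, _, (Regenerates.univ_id _).prod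
      ((regenerates_drop (fun _ => (PMF.uniformOfFintype (Fin n)).toMeasure) 0 Nat.succ hsucc
        Nat.succ_ne_zero (fun _ => rfl)
        (A := {i | ({ q with
          actions := E.respond q.better q.actions (insert i (G.strong.neighborSet i)) } :
            G.State) = q'}) .of_discrete).prod (.univ_id _)), rfl, ?_⟩
    ext ω
    simp [react]
  | recovery e =>
    by_cases h : ({ q with dormant := insert e q.dormant } : G.State) = q'
    · refine ⟨_, _, Regenerates.univ_id _, rfl, ?_⟩
      ext ω
      simp [react, h]
    · refine ⟨∅, id, ⟨measurable_id, .empty, by simp⟩, rfl, ?_⟩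
      ext ω
      simp [react, h]

theorem lawReal_startsWith_inter_react (E : G.Equilibrium) (c : G.Clock) (q q' : G.State)
    {D : Set G.Sample} (hD : MeasurableSet D) :
    G.law.real (startsWith c ∩ {ω | react E ω c 0 q = q'} ∩ afterTick c ⁻¹' D) =
      tickProb c * stepProb E c q q' * G.law.real D := by
  simp only [measureReal_def, stepProb, law_startsWith_inter_react E c q q' hD, ENNReal.toReal_mul,
    ENNReal.toReal_ofReal (tickProb_pos c).le]

/-- A probability splits over the values of a map to a finite type. -/
theorem sum_lawReal_inter_fiber {α : Type*} [Fintype α] [MeasurableSpace α]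
    [MeasurableSingletonClass α] {f : G.Sample → α} (hf : Measurable f) {S : Set G.Sample}
    (hS : MeasurableSet S) : ∑ a, G.law.real (S ∩ {ω | f ω = a}) = G.law.real S := by
  rw [← measureReal_biUnion_finset]
  · congr 1
    ext ω
    simp
  · intro a _ b _ hab
    refine Set.disjoint_left.2 fun ω h1 h2 => hab ?_
    exact h1.2.symm.trans h2.2
  · exact fun a _ => hS.inter (hf (measurableSet_singleton a))

theorem sum_lawReal_fiber {α : Type*} [Fintype α] [MeasurableSpace α]
    [MeasurableSingletonClass α] {f : G.Sample → α} (hf : Measurable f) :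
    ∑ a, G.law.real {ω | f ω = a} = 1 := by
  simpa using sum_lawReal_inter_fiber hf MeasurableSet.univ

theorem stepProb_nonneg (E : G.Equilibrium) (c : G.Clock) (q q' : G.State) :
    0 ≤ stepProb E c q q' := measureReal_nonneg

theorem sum_stepProb (E : G.Equilibrium) (c : G.Clock) (q : G.State) :
    ∑ q', stepProb E c q q' = 1 := sum_lawReal_fiber (measurable_react E c 0 q)

theorem lawReal_startsWith_inter (E : G.Equilibrium) (c : G.Clock) (q : G.State)
    (D : G.State → Set G.Sample) (hD : ∀ q', MeasurableSet (D q')) :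
    G.law.real (startsWith c ∩ {ω | afterTick c ω ∈ D (react E ω c 0 q)}) =
      tickProb c * ∑ q', stepProb E c q q' * G.law.real (D q') := by
  have h : ∀ q', startsWith c ∩ {ω | afterTick c ω ∈ D (react E ω c 0 q)} ∩
      {ω | react E ω c 0 q = q'} =
      startsWith c ∩ {ω | react E ω c 0 q = q'} ∩ afterTick c ⁻¹' D q' := by
    intro q'
    ext ω
    simp only [Set.mem_inter_iff, Set.mem_ofPred_eq, Set.mem_preimage]
    constructor
    · rintro ⟨⟨h1, h2⟩, rfl⟩; exact ⟨⟨h1, rfl⟩, h2⟩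
    · rintro ⟨⟨h1, rfl⟩, h2⟩; exact ⟨⟨h1, h2⟩, rfl⟩
  have hm : MeasurableSet (startsWith c ∩ {ω | afterTick c ω ∈ D (react E ω c 0 q)}) := by
    have : startsWith c ∩ {ω | afterTick c ω ∈ D (react E ω c 0 q)} =
        ⋃ q', startsWith c ∩ {ω | react E ω c 0 q = q'} ∩ afterTick c ⁻¹' D q' := by
      simp only [← h]
      ext ω
      simp
    rw [this]
    exact .iUnion fun q' => ((measurableSet_startsWith c).inter (measurableSet_react E c 0 q q')).inter
      (measurable_afterTick c (hD q'))
  rw [← sum_lawReal_inter_fiber (measurable_react E c 0 q) hm, Finset.mul_sum]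
  refine Finset.sum_congr rfl fun q' _ => ?_
  rw [h, lawReal_startsWith_inter_react E c q q' (hD q'), mul_assoc]

theorem lawReal_startsWith_inter_preimage (c : G.Clock) {D : Set G.Sample}
    (hD : MeasurableSet D) :
    G.law.real (startsWith c ∩ afterTick c ⁻¹' D) = tickProb c * G.law.real D := by
  obtain ⟨E⟩ : Nonempty G.Equilibrium := inferInstance
  have q : G.State := ⟨fun _ => false, false, ∅⟩
  have h := lawReal_startsWith_inter E c q (fun _ => D) fun _ => hD
  rw [← Finset.sum_mul, sum_stepProb, one_mul] at h
  exact h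

theorem lawReal_startsWith (c : G.Clock) : G.law.real (startsWith c) = tickProb c := by
  have h := lawReal_startsWith_inter_preimage c MeasurableSet.univ
  simpa using h

/-- Almost surely, one clock ticks strictly before all others. -/
theorem ae_exists_startsWith (G : Society n) : ∀ᵐ ω ∂G.law, ∃ c, ω ∈ startsWith c := by
  have hm : MeasurableSet (⋃ c : G.Clock, startsWith c) :=
    .iUnion fun c => measurableSet_startsWith c
  have h : G.law.real (⋃ c : G.Clock, startsWith c) = 1 := by
    rw [← Set.biUnion_univ, ← Finset.coe_univ]
    have := measureReal_biUnion_finset (μ := G.law) (s := Finset.univ) (f := startsWith (G := G))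
      (fun c _ c' _ hne => disjoint_startsWith hne) (fun c _ => measurableSet_startsWith c)
    rw [Finset.sum_congr rfl fun c _ => lawReal_startsWith c, G.sum_tickProb] at this
    exact this
  have h1 : G.law (⋃ c : G.Clock, startsWith c) = 1 := by
    rw [← ENNReal.ofReal_one, ← h, ofReal_measureReal]
  filter_upwards [(prob_compl_eq_zero_iff hm).2 h1 |> compl_mem_ae_iff.2] with ω hω
  simpa using hω

theorem sum_lawReal_startsWith_inter {S : Set G.Sample} (hS : MeasurableSet S) :
    ∑ c, G.law.real (startsWith c ∩ S) = G.law.real S := by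
  rw [← measureReal_biUnion_finset]
  · refine measureReal_congr ?_
    filter_upwards [ae_exists_startsWith G] with ω hω
    refine propext ?_
    change ω ∈ (⋃ c ∈ Finset.univ, startsWith c ∩ S) ↔ ω ∈ S
    simpa using fun _ => hω
  · exact fun c _ c' _ h => (disjoint_startsWith h).mono Set.inter_subset_left Set.inter_subset_left
  · exact fun c _ => (measurableSet_startsWith c).inter hS

theorem ae_positiveWaits (G : Society n) : ∀ᵐ ω ∂G.law, ω ∈ positiveWaits G := by
  have : ∀ p : G.Clock × ℕ, ∀ᵐ ω ∂G.law, 0 < ω.1 p := fun p => by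
    have h : MeasurePreserving (fun ω : G.Sample => ω.1 p) G.law (expMeasure p.1.rate) :=
      (measurePreserving_eval_infinitePi (fun p : G.Clock × ℕ => expMeasure p.1.rate) p).comp
        measurePreserving_fst
    exact h.quasiMeasurePreserving.ae (expMeasure_ae_pos p.1.rate_pos)
  exact ae_all_iff.2 this

/-- Almost surely, every payoff shock comes after finitely many ticks. The first tick gives
the probability `w k` that the shock `k` never comes the bound
`w (k + 1) ≤ s * w k + (1 - s) * w (k + 1)` with `s > 0`. -/
theorem lawReal_neverShock (G : Society n) (k : ℕ) : G.law.real (neverShock G k) = 0 := by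
  induction k with
  | zero =>
    have h : G.law (neverShock G 0) = 0 := by
      refine measure_eq_zero_iff_ae_notMem.2 ?_
      filter_upwards [ae_positiveWaits G] with ω hω using notMem_neverShock_zero hω
    rw [measureReal_def, h, ENNReal.toReal_zero]
  | succ k ih =>
    set w := G.law.real (neverShock G (k + 1)) with hw
    have h1 : ∀ c : G.Clock, c ≠ .shock →
        G.law.real (startsWith c ∩ neverShock G (k + 1)) ≤ tickProb c * w := by
      intro c hc
      rw [hw, ← lawReal_startsWith_inter_preimage c (measurableSet_neverShock (k + 1))]
      exact measureReal_mono fun ω hω =>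
        ⟨hω.1, mem_neverShock_afterTick_of_ne hω.1 hc k hω.2⟩
    have h2 : G.law.real (startsWith .shock ∩ neverShock G (k + 1)) ≤ 0 := by
      have := lawReal_startsWith_inter_preimage .shock (measurableSet_neverShock (G := G) k)
      rw [ih, mul_zero] at this
      rw [← this]
      exact measureReal_mono fun ω hω => ⟨hω.1, mem_neverShock_afterTick_shock hω.1 k hω.2⟩
    have h3 := sum_lawReal_startsWith_inter (measurableSet_neverShock (G := G) (k + 1))
    rw [← Finset.add_sum_erase _ _ (Finset.mem_univ Clock.shock), ← hw] at h3
    have h4 := Finset.sum_le_sum fun c (hc : c ∈ Finset.univ.erase (Clock.shock (G := G))) =>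
      h1 c (Finset.ne_of_mem_erase hc)
    rw [← Finset.sum_mul] at h4
    have h5 := G.sum_tickProb
    rw [← Finset.add_sum_erase _ _ (Finset.mem_univ Clock.shock)] at h5
    have h6 := tickProb_pos (Clock.shock (G := G))
    have h7 : 0 ≤ w := measureReal_nonneg
    have h8 : ∑ c ∈ Finset.univ.erase (Clock.shock (G := G)), tickProb c =
        1 - tickProb (Clock.shock (G := G)) := by linarith
    rw [h8] at h4
    nlinarith

theorem ae_notMem_neverShock (G : Society n) (k : ℕ) : ∀ᵐ ω ∂G.law, ω ∉ neverShock G k :=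
  measure_eq_zero_iff_ae_notMem.1 ((measureReal_eq_zero_iff).1 (lawReal_neverShock G k))

/-! ### First-step equations -/

/-- The probability that coin 0 shows `R` and that, from the state `q` at time 0, the state at the
`k`-th payoff shock is `q'`. Coin 0 is tracked because the initial state of the society depends on
it. -/
def coinHit (E : G.Equilibrium) (k : ℕ) (R : Bool) (q q' : G.State) : ℝ :=
  G.law.real {ω | ω.2.1 0 = R ∧ stateAtShock E k q ω = q'}

theorem lawReal_coin (j : ℕ) (R : Bool) : G.law.real {ω : G.Sample | ω.2.1 j = R} = 1 / 2 := by
  have h : MeasurePreserving (fun ω : G.Sample => ω.2.1 j) G.law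
      (PMF.uniformOfFintype Bool).toMeasure :=
    (measurePreserving_eval_infinitePi (fun _ : ℕ => (PMF.uniformOfFintype Bool).toMeasure) j).comp
      (measurePreserving_fst.comp measurePreserving_snd)
  have := h.measureReal_preimage (s := {R}) (by measurability)
  rw [show {ω : G.Sample | ω.2.1 j = R} = (fun ω : G.Sample => ω.2.1 j) ⁻¹' {R} from rfl, this,
    measureReal_def, PMF.toMeasure_apply_singleton _ _ (measurableSet_singleton R)]
  simp

theorem coinHit_startsWith_of_ne (E : G.Equilibrium) (k : ℕ) (R : Bool) (q q' : G.State)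
    {c : G.Clock} (hc : c ≠ .shock) :
    G.law.real (startsWith c ∩ {ω | ω.2.1 0 = R ∧ stateAtShock E (k + 1) q ω = q'}) =
      tickProb c * ∑ q₁, stepProb E c q q₁ * coinHit E (k + 1) R q₁ q' := by
  rw [show ∑ q₁, stepProb E c q q₁ * coinHit E (k + 1) R q₁ q' = ∑ q₁, stepProb E c q q₁ *
      G.law.real {ω | ω.2.1 0 = R ∧ stateAtShock E (k + 1) q₁ ω = q'} from rfl,
    ← lawReal_startsWith_inter E c q _ fun q₁ => measurableSet_coinHit E (k + 1) R q₁ q']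
  refine measureReal_congr ?_
  filter_upwards [ae_positiveWaits G, ae_notMem_neverShock G (k + 1)] with ω hpos hnev
  refine propext (and_congr_right fun h => ?_)
  change (ω.2.1 0 = R ∧ stateAtShock E (k + 1) q ω = q') ↔ ((afterTick c ω).2.1 0 = R ∧ _ = q')
  rw [stateAtShock_of_ne h hpos hc E q k hnev, afterTick_coin_zero]

theorem coinHit_one (E : G.Equilibrium) (R : Bool) (q q' : G.State) :
    coinHit E 1 R q q' = tickProb (.shock : G.Clock) * (if q = q' then 1 / 2 else 0) +
      ∑ c ∈ Finset.univ.erase Clock.shock,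
        tickProb c * ∑ q₁, stepProb E c q q₁ * coinHit E 1 R q₁ q' := by
  rw [coinHit, ← sum_lawReal_startsWith_inter (measurableSet_coinHit E 1 R q q'),
    ← Finset.add_sum_erase _ _ (Finset.mem_univ Clock.shock)]
  congr 1
  · split_ifs with h
    · rw [← lawReal_coin (G := G) 0 R,
        ← lawReal_startsWith_inter_preimage .shock (measurableSet_coin_zero R)]
      congr 1
      ext ω
      refine and_congr_right fun hω => ?_
      change (ω.2.1 0 = R ∧ stateAtShock E 1 q ω = q') ↔ (afterTick .shock ω).2.1 0 = R
      rw [stateAtShock_one_shock hω, afterTick_coin_zero]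
      exact and_iff_left h
    · rw [mul_zero, measureReal_eq_zero_iff]
      convert measure_empty (μ := G.law)
      refine Set.eq_empty_of_forall_notMem fun ω hω => h ?_
      rw [← stateAtShock_one_shock hω.1 E q]
      exact hω.2.2
  · exact Finset.sum_congr rfl fun c hc =>
      coinHit_startsWith_of_ne E 0 R q q' (Finset.ne_of_mem_erase hc)

theorem coinHit_add_two (E : G.Equilibrium) (k : ℕ) (R : Bool) (q q' : G.State) :
    coinHit E (k + 2) R q q' =
      tickProb (.shock : G.Clock) * ∑ q₁, stepProb E .shock q q₁ * coinHit E (k + 1) R q₁ q' +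
      ∑ c ∈ Finset.univ.erase Clock.shock,
        tickProb c * ∑ q₁, stepProb E c q q₁ * coinHit E (k + 2) R q₁ q' := by
  rw [coinHit, ← sum_lawReal_startsWith_inter (measurableSet_coinHit E (k + 2) R q q'),
    ← Finset.add_sum_erase _ _ (Finset.mem_univ Clock.shock)]
  congr 1
  · rw [show ∑ q₁, stepProb E .shock q q₁ * coinHit E (k + 1) R q₁ q' =
      ∑ q₁, stepProb E .shock q q₁ *
        G.law.real {ω | ω.2.1 0 = R ∧ stateAtShock E (k + 1) q₁ ω = q'} from rfl,
      ← lawReal_startsWith_inter E .shock q _ fun q₁ => measurableSet_coinHit E (k + 1) R q₁ q']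
    refine measureReal_congr ?_
    filter_upwards [ae_positiveWaits G, ae_notMem_neverShock G (k + 2)] with ω hpos hnev
    refine propext (and_congr_right fun h => ?_)
    change (ω.2.1 0 = R ∧ stateAtShock E (k + 2) q ω = q') ↔
      ((afterTick .shock ω).2.1 0 = R ∧ _ = q')
    rw [stateAtShock_shock h hpos E q k hnev, afterTick_coin_zero]
  · exact Finset.sum_congr rfl fun c hc =>
      coinHit_startsWith_of_ne E (k + 1) R q q' (Finset.ne_of_mem_erase hc)

end

/-! ### Equilibrium profiles -/

theorem isContinuation_observers {R : Bool} {a b : Profile n} {J : Set (Fin n)}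
    (h : G.IsContinuation R a J b) :
    ∀ i ∈ G.observers b, G.payoff R b i (!(b i)) ≤ G.payoff R b i (b i) := by
  obtain ⟨K, hK, hbest⟩ := h
  suffices H : ∀ s : Profile n × Set (Fin n),
      Relation.ReflTransGen (G.Revises R) (a, J ∪ G.observers a) s → G.observers s.1 ⊆ s.2 from
    fun i hi => hbest i (H _ hK hi)
  intro s hs
  rcases Relation.ReflTransGen.cases_tail hs with h | ⟨s', -, i, -, -, h1, h2⟩
  · rw [h]; exact Set.subset_union_right
  · rw [h2]; exact Set.subset_union_right

theorem isContinuation_unique_of_observers {R : Bool} {a b : Profile n}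
    (ha : ∀ i ∈ G.observers a, G.payoff R a i (!(a i)) ≤ G.payoff R a i (a i))
    (h : G.IsContinuation R a ∅ b) : b = a := by
  obtain ⟨K, hK, -⟩ := h
  rcases Relation.ReflTransGen.cases_head hK with h | ⟨s, ⟨i, hi, hlt, -⟩, -⟩
  · exact (Prod.mk.inj h).1.symm
  · rw [Set.empty_union] at hi
    exact absurd hlt (not_lt.2 (ha i hi))

/-- The states at which no agent revises her action unless new information arrives. -/
def equilibriumStates (E : G.Equilibrium) : Set G.State :=
  {q | E.respond q.better q.actions ∅ = q.actions}

/-- Equilibrium profiles persist when nobody receives information: all observers already play best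
responses, so that no revision is possible. -/
theorem respond_respond (E : G.Equilibrium) (R : Bool) (a : Profile n) (J : Set (Fin n)) :
    E.respond R (E.respond R a J) ∅ = E.respond R a J :=
  isContinuation_unique_of_observers (isContinuation_observers (E.isContinuation R a J))
    (E.isContinuation R _ ∅)

theorem start_mem_equilibriumStates (E : G.Equilibrium) (P : Profile n) (R : Bool)
    (B : Finset G.Link) : start E P R B ∈ equilibriumStates E := respond_respond E R P ∅

theorem react_mem_equilibriumStates (E : G.Equilibrium) (ω : G.Sample) (c : G.Clock) (k : ℕ)
    {q : G.State} (hq : q ∈ equilibriumStates E) : react E ω c k q ∈ equilibriumStates E := by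
  cases c with
  | shock => exact respond_respond E _ _ _
  | activation =>
    unfold react
    split_ifs
    · exact respond_respond E _ _ _
    · exact hq
  | tremble => exact respond_respond E _ _ _
  | recovery e => exact hq

theorem react_better (E : G.Equilibrium) (ω : G.Sample) {c : G.Clock} (hc : c ≠ .shock) (k : ℕ)
    (q : G.State) : (react E ω c k q).better = q.better := by
  cases c with
  | shock => exact absurd rfl hc
  | activation =>
    unfold react
    split_ifs <;> rfl
  | tremble => rfl
  | recovery e => rfl

/-- If network payoffs are too small to outweigh the material payoff, informed agents end up with
the better action, and those that play it stay with it. -/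
theorem respond_eq_better (hτ : ∀ i, G.tau * G.degree i < 1) (E : G.Equilibrium) (R : Bool)
    (a : Profile n) (J : Set (Fin n)) (i : Fin n) (hi : i ∈ J ∨ a i = R) :
    E.respond R a J i = R := by
  have hpay : ∀ (b : Profile n) (i : Fin n), G.payoff R b i (!R) < G.payoff R b i R := by
    intro b i
    have h1 : (({j | G.strong.Adj i j ∧ b j = !R} : Set (Fin n)).ncard : ℝ) ≤ G.degree i := by
      exact_mod_cast Set.ncard_le_ncard (t := G.strong.neighborSet i)
        (fun j hj => And.left hj) (Set.toFinite _)
    have h2 : G.tau * (({j | G.strong.Adj i j ∧ b j = !R} : Set (Fin n)).ncard : ℝ) < 1 :=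
      (mul_le_mul_of_nonneg_left h1 G.tau_nonneg).trans_lt (hτ i)
    have h3 : 0 ≤ G.tau * (({j | G.strong.Adj i j ∧ b j = R} : Set (Fin n)).ncard : ℝ) :=
      mul_nonneg G.tau_nonneg (Nat.cast_nonneg _)
    simp only [payoff, if_true, Bool.not_eq_self, if_false]
    linarith
  obtain ⟨K, hK, hbest⟩ := E.isContinuation R a J
  have hinv : ∀ s : Profile n × Set (Fin n),
      Relation.ReflTransGen (G.Revises R) (a, J ∪ G.observers a) s → i ∈ s.2 ∨ s.1 i = R := by
    intro s hs
    induction hs with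
    | refl => exact hi.imp (fun h => .inl h) id
    | tail _ hstep ih =>
      obtain ⟨j, -, hlt, h1, h2⟩ := hstep
      rcases ih with h | h
      · exact .inl (h2 ▸ .inl h)
      · refine .inr ?_
        rw [h1]
        by_cases hij : i = j
        · subst hij
          rw [h] at hlt
          exact absurd hlt (not_lt.2 (hpay _ i).le)
        · rw [Function.update_of_ne hij, h]
  rcases hinv _ hK with h | h
  · by_contra hne
    have hR : E.respond R a J i = !R := by
      cases h' : E.respond R a J i <;> cases R <;> simp_all
    have := hbest i h
    rw [hR, Bool.not_not] at this
    exact absurd this (not_le.2 (hpay _ i))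
  · exact h

/-! ### The state at a payoff shock -/

theorem measurable_atShock (E : G.Equilibrium) (k : ℕ) :
    Measurable fun ω : G.Sample => atShock E k ω := by
  have h : Measurable fun p : Bool × G.Sample =>
      stateAtShock E k (start E (fun _ => false) p.1 Finset.univ) p.2 :=
    measurable_from_prod_countable_right fun R =>
      measurable_stateAtShock E k (start E (fun _ => false) R Finset.univ)
  exact h.comp ((by fun_prop : Measurable fun ω : G.Sample => ω.2.1 0).prodMk measurable_id)

theorem welfare_eq_sum (E : G.Equilibrium) (k : ℕ) :
    welfare E k = fun ω => ∑ q, Set.indicator {ω | atShock E k ω = q} (fun _ => q.fraction) ω := by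
  classical
  funext ω
  simp [welfare, Set.indicator_apply]

section

variable [NeZero n]

/-! ### The transition matrix -/

/-- The probabilities of the states at the end of an epoch, given the state at its start. -/
def epochMatrix (E : G.Equilibrium) : Matrix G.State G.State ℝ :=
  .of fun q q' => G.law.real {ω | stateAtShock E 1 q ω = q'}

/-- The transition probabilities at a payoff shock. -/
def shockMatrix (E : G.Equilibrium) : Matrix G.State G.State ℝ := .of (stepProb E .shock)

/-- The transition probabilities at a tick, restricted to the ticks that are not payoff shocks. -/
def interimMatrix (E : G.Equilibrium) : Matrix G.State G.State ℝ :=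
  .of fun q q' => ∑ c ∈ Finset.univ.erase Clock.shock, tickProb c * stepProb E c q q'

/-- The matrix of the probabilities `coinHit`. -/
def coinMatrix (E : G.Equilibrium) (k : ℕ) (R : Bool) : Matrix G.State G.State ℝ :=
  .of (coinHit E k R)

theorem interimMatrix_nonneg (E : G.Equilibrium) (q q' : G.State) : 0 ≤ interimMatrix E q q' :=
  Finset.sum_nonneg fun c _ => mul_nonneg (tickProb_pos c).le (stepProb_nonneg E c q q')

theorem sum_interimMatrix (E : G.Equilibrium) (q : G.State) :
    ∑ q', interimMatrix E q q' = 1 - tickProb (.shock : G.Clock) := by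
  simp only [interimMatrix, Matrix.of_apply]
  rw [Finset.sum_comm]
  simp only [← Finset.mul_sum, sum_stepProb, mul_one]
  rw [← G.sum_tickProb, ← Finset.add_sum_erase _ _ (Finset.mem_univ Clock.shock)]
  ring

theorem interimMatrix_eq_zero (E : G.Equilibrium) {A : Set G.State}
    (hA : ∀ ω, ∀ c ≠ Clock.shock, ∀ q ∈ A, react E ω c 0 q ∈ A) {q q' : G.State} (hq : q ∈ A)
    (hq' : q' ∉ A) : interimMatrix E q q' = 0 := by
  refine Finset.sum_eq_zero fun c hc => ?_
  have : {ω | react E ω c 0 q = q'} = ∅ := Set.eq_empty_of_forall_notMem fun ω hω =>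
    hq' (hω ▸ hA ω c (Finset.ne_of_mem_erase hc) q hq)
  rw [stepProb, this, measureReal_empty, mul_zero]

/-- First-step equations have at most one solution. -/
theorem eq_zero_of_interim (E : G.Equilibrium) {v : G.State → ℝ}
    (hv : ∀ q, |v q| ≤ ∑ q', interimMatrix E q q' * |v q'|) : v = 0 :=
  eq_zero_of_abs_le_substochastic (interimMatrix_nonneg E)
    (sub_lt_self 1 (tickProb_pos (.shock : G.Clock))) (fun q => (sum_interimMatrix E q).le) hv

theorem eq_of_interim (E : G.Equilibrium) {X Y Z : Matrix G.State G.State ℝ}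
    (hX : X = Z + interimMatrix E * X) (hY : Y = Z + interimMatrix E * Y) : X = Y := by
  ext q q'
  have hd : X - Y = interimMatrix E * (X - Y) := by
    rw [Matrix.mul_sub]
    nth_rewrite 1 [hX, hY]
    abel
  have := eq_zero_of_interim E (v := fun q => (X - Y) q q') fun q => by
    conv_lhs => rw [hd, Matrix.mul_apply]
    refine (Finset.abs_sum_le_sum_abs _ _).trans (Finset.sum_le_sum fun r _ => ?_)
    rw [abs_mul, abs_of_nonneg (interimMatrix_nonneg E q r)]
  exact sub_eq_zero.1 (congrFun this q)

theorem sum_erase_eq_interim_mul (E : G.Equilibrium) (X : Matrix G.State G.State ℝ)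
    (q q' : G.State) :
    ∑ c ∈ Finset.univ.erase Clock.shock, tickProb c * ∑ q₁, stepProb E c q q₁ * X q₁ q' =
      (interimMatrix E * X) q q' := by
  simp only [Matrix.mul_apply, interimMatrix, Matrix.of_apply, Finset.sum_mul, Finset.mul_sum]
  rw [Finset.sum_comm]
  exact Finset.sum_congr rfl fun _ _ => Finset.sum_congr rfl fun _ _ => (mul_assoc _ _ _).symm

theorem coinMatrix_one_eq (E : G.Equilibrium) (R : Bool) :
    coinMatrix E 1 R = (tickProb (.shock : G.Clock) * (1 / 2)) • (1 : Matrix G.State G.State ℝ) +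
      interimMatrix E * coinMatrix E 1 R := by
  ext q q'
  rw [Matrix.add_apply, ← sum_erase_eq_interim_mul, Matrix.smul_apply, Matrix.one_apply]
  refine (coinHit_one E R q q').trans ?_
  congr 1
  split_ifs <;> simp

theorem coinMatrix_add_two_eq (E : G.Equilibrium) (k : ℕ) (R : Bool) :
    coinMatrix E (k + 2) R =
      tickProb (.shock : G.Clock) • (shockMatrix E * coinMatrix E (k + 1) R) +
      interimMatrix E * coinMatrix E (k + 2) R := by
  ext q q'
  rw [Matrix.add_apply, ← sum_erase_eq_interim_mul, Matrix.smul_apply, Matrix.mul_apply]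
  exact coinHit_add_two E k R q q'

theorem epochMatrix_eq_add (E : G.Equilibrium) :
    epochMatrix E = coinMatrix E 1 true + coinMatrix E 1 false := by
  ext q q'
  have h := sum_lawReal_inter_fiber (G := G) (f := fun ω => ω.2.1 0) (by fun_prop)
    (measurable_stateAtShock E 1 q (measurableSet_singleton q'))
  rw [Fintype.sum_bool] at h
  have e : ∀ R, coinHit E 1 R q q' = G.law.real
      (stateAtShock E 1 q ⁻¹' {q'} ∩ {ω : G.Sample | ω.2.1 0 = R}) := fun R => by
    rw [coinHit]
    congr 1
    ext ω
    exact and_comm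
  change G.law.real _ = coinHit E 1 true q q' + coinHit E 1 false q q'
  rw [e, e, h]
  rfl

theorem coinMatrix_one (E : G.Equilibrium) (R : Bool) :
    coinMatrix E 1 R = (1 / 2 : ℝ) • epochMatrix E := by
  have h : ∀ R', coinMatrix E 1 R' = coinMatrix E 1 R := fun R' =>
    eq_of_interim E (coinMatrix_one_eq E R') (coinMatrix_one_eq E R)
  rw [epochMatrix_eq_add, h true, h false, ← two_smul ℝ, smul_smul]
  norm_num

theorem epochMatrix_eq (E : G.Equilibrium) :
    epochMatrix E = tickProb (.shock : G.Clock) • (1 : Matrix G.State G.State ℝ) +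
      interimMatrix E * epochMatrix E := by
  conv_lhs => rw [epochMatrix_eq_add, coinMatrix_one_eq E true, coinMatrix_one_eq E false]
  rw [epochMatrix_eq_add, Matrix.mul_add]
  module

/-- The renewal formula: the law of the state at the shock `k + 1` is a product of one matrix for each
epoch and each intermediate shock, and coin 0 is independent of this state. -/
theorem coinMatrix_succ (E : G.Equilibrium) (k : ℕ) (R : Bool) :
    coinMatrix E (k + 1) R =
      (1 / 2 : ℝ) • (epochMatrix E * (shockMatrix E * epochMatrix E) ^ k) := by
  induction k with
  | zero => rw [pow_zero, mul_one, coinMatrix_one]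
  | succ k ih =>
    have h : coinMatrix E (k + 2) R = epochMatrix E * (shockMatrix E * coinMatrix E (k + 1) R) := by
      refine eq_of_interim E (coinMatrix_add_two_eq E k R) ?_
      conv_lhs => rw [epochMatrix_eq]
      rw [Matrix.add_mul, Matrix.smul_mul, Matrix.one_mul, Matrix.mul_assoc]
    rw [h, ih, pow_succ', Matrix.mul_smul, Matrix.mul_smul]
    simp only [Matrix.mul_assoc]

theorem epochMatrix_nonneg (E : G.Equilibrium) (q q' : G.State) : 0 ≤ epochMatrix E q q' :=
  measureReal_nonneg

theorem sum_epochMatrix (E : G.Equilibrium) (q : G.State) : ∑ q', epochMatrix E q q' = 1 :=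
  sum_lawReal_fiber (measurable_stateAtShock E 1 q)

/-- An epoch does not leave a set of states that the ticks other than payoff shocks do not leave. -/
theorem epochMatrix_eq_zero (E : G.Equilibrium) {A : Set G.State}
    (hA : ∀ ω, ∀ c ≠ Clock.shock, ∀ q ∈ A, react E ω c 0 q ∈ A) {q q' : G.State} (hq : q ∈ A)
    (hq' : q' ∉ A) : epochMatrix E q q' = 0 := by
  classical
  have h := eq_zero_of_interim E (v := fun q => if q ∈ A then epochMatrix E q q' else 0) fun a => by
    by_cases ha : a ∈ A
    · have hne : a ≠ q' := fun h => hq' (h ▸ ha)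
      simp only [ha, if_true]
      conv_lhs => rw [epochMatrix_eq, Matrix.add_apply, Matrix.smul_apply, Matrix.one_apply_ne hne,
        smul_zero, zero_add, Matrix.mul_apply]
      refine (Finset.abs_sum_le_sum_abs _ _).trans (Finset.sum_le_sum fun b _ => ?_)
      by_cases hb : b ∈ A
      · simp [hb, abs_mul, abs_of_nonneg (interimMatrix_nonneg E a b)]
      · simp [interimMatrix_eq_zero E hA ha hb]
    · simp only [ha, if_false, abs_zero]
      exact Finset.sum_nonneg fun b _ => mul_nonneg (interimMatrix_nonneg E a b) (abs_nonneg _)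
  simpa [hq] using congrFun h q

theorem epochMatrix_self_pos (E : G.Equilibrium) (q : G.State) : 0 < epochMatrix E q q := by
  rw [epochMatrix_eq, Matrix.add_apply, Matrix.smul_apply, Matrix.one_apply_eq, Matrix.mul_apply]
  refine add_pos_of_pos_of_nonneg (by simpa using tickProb_pos _) (Finset.sum_nonneg fun r _ => ?_)
  exact mul_nonneg (interimMatrix_nonneg E q r) (epochMatrix_nonneg E r q)

theorem epochMatrix_pos_of_step (E : G.Equilibrium) {c : G.Clock} (hc : c ≠ .shock)
    {q q₁ q' : G.State} (h : 0 < stepProb E c q q₁) (h' : 0 < epochMatrix E q₁ q') :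
    0 < epochMatrix E q q' := by
  have hpos : 0 < interimMatrix E q q₁ :=
    (mul_pos (tickProb_pos c) h).trans_le
      (Finset.single_le_sum (f := fun c => tickProb c * stepProb E c q q₁)
        (fun c _ => mul_nonneg (tickProb_pos c).le (stepProb_nonneg E c q q₁))
        (Finset.mem_erase.2 ⟨hc, Finset.mem_univ c⟩))
  rw [epochMatrix_eq, Matrix.add_apply, Matrix.smul_apply, Matrix.mul_apply]
  refine add_pos_of_nonneg_of_pos ?_ ((mul_pos hpos h').trans_le
    (Finset.single_le_sum (f := fun r => interimMatrix E q r * epochMatrix E r q')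
      (fun r _ => mul_nonneg (interimMatrix_nonneg E q r) (epochMatrix_nonneg E r q'))
      (Finset.mem_univ q₁)))
  rw [Matrix.one_apply]
  split_ifs <;> simp [(tickProb_pos _).le]

theorem sum_stepProb_shock_mul (E : G.Equilibrium) (q : G.State) (v : G.State → ℝ) :
    ∑ q₁, stepProb E .shock q q₁ * v q₁ =
      1 / 2 * (v (start E q.actions true q.dormant) + v (start E q.actions false q.dormant)) := by
  have h : ∀ q₁, stepProb E .shock q q₁ =
      1 / 2 * ((if start E q.actions true q.dormant = q₁ then 1 else 0) +
        if start E q.actions false q.dormant = q₁ then 1 else 0) := by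
    intro q₁
    have hs := sum_lawReal_inter_fiber (G := G) (f := fun ω => ω.2.1 1) (by fun_prop)
      (measurableSet_react E .shock 0 q q₁)
    rw [Fintype.sum_bool] at hs
    have e : ∀ R, G.law.real ({ω : G.Sample | react E ω .shock 0 q = q₁} ∩ {ω | ω.2.1 1 = R}) =
        1 / 2 * if start E q.actions R q.dormant = q₁ then 1 else 0 := by
      intro R
      have hset : {ω : G.Sample | react E ω .shock 0 q = q₁} ∩ {ω | ω.2.1 1 = R} =
          if start E q.actions R q.dormant = q₁ then {ω | ω.2.1 1 = R} else ∅ := by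
        ext ω
        split_ifs with h
        · refine and_iff_right_of_imp fun hR => ?_
          rw [← h, ← show ω.2.1 1 = R from hR]
          rfl
        · refine iff_of_false (fun h' => h ?_) (Set.notMem_empty _)
          rw [← h'.1, ← show ω.2.1 1 = R from h'.2]
          rfl
      rw [hset]
      split_ifs
      · rw [lawReal_coin, mul_one]
      · rw [measureReal_empty, mul_zero]
    rw [stepProb, ← hs, e, e, mul_add]
  simp only [h, mul_assoc, ← Finset.mul_sum, add_mul, ite_mul, one_mul, zero_mul,
    Finset.sum_add_distrib, Finset.sum_ite_eq, Finset.mem_univ, if_true]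

theorem epochMatrix_eq_zero_of_better_ne (E : G.Equilibrium) {q q' : G.State}
    (h : q'.better ≠ q.better) : epochMatrix E q q' = 0 :=
  epochMatrix_eq_zero E (A := {r | r.better = q.better})
    (fun ω _ hc r hr => (react_better E ω hc 0 r).trans hr) rfl h

theorem transition_eq (E : G.Equilibrium) (q q' : G.State) :
    transition E q q' = 1 / 2 * epochMatrix E (start E q.actions q'.better q.dormant) q' := by
  rw [transition, epochProb]
  congr 1
  have hset : {ω : G.Sample | (stateAt E ω (start E q.actions q'.better q.dormant)
      (shockTime ω 1)).actions = q'.actions ∧ (stateAt E ω (start E q.actions q'.better q.dormant)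
      (shockTime ω 1)).dormant = q'.dormant} =
      {ω | stateAtShock E 1 (start E q.actions q'.better q.dormant) ω = q'} ∪
        {ω | stateAtShock E 1 (start E q.actions q'.better q.dormant) ω =
          ⟨q'.actions, !q'.better, q'.dormant⟩} := by
    ext ω
    change _ ↔ stateAtShock E 1 _ ω = q' ∨ stateAtShock E 1 _ ω = ⟨_, _, _⟩
    rw [State.ext_iff, State.ext_iff]
    change (stateAtShock E 1 _ ω).actions = _ ∧ (stateAtShock E 1 _ ω).dormant = _ ↔ _
    rcases Bool.eq_or_eq_not (stateAtShock E 1 (start E q.actions q'.better q.dormant) ω).better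
      q'.better with h | h <;> simp [h]
  have hzero := epochMatrix_eq_zero_of_better_ne E
    (q := start E q.actions q'.better q.dormant) (q' := ⟨q'.actions, !q'.better, q'.dormant⟩)
    (by simp [start])
  rw [hset]
  refine le_antisymm ?_ (measureReal_mono Set.subset_union_left)
  refine (measureReal_union_le _ _).trans (le_of_eq ?_)
  exact (congrArg₂ (· + ·) rfl hzero).trans (add_zero _)

theorem of_transition (E : G.Equilibrium) :
    (.of (transition E) : Matrix G.State G.State ℝ) = shockMatrix E * epochMatrix E := by
  ext q q'
  rw [Matrix.of_apply, transition_eq, Matrix.mul_apply]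
  refine Eq.trans ?_ (sum_stepProb_shock_mul E q fun r => epochMatrix E r q').symm
  cases h : q'.better
  · rw [epochMatrix_eq_zero_of_better_ne E (q := start E q.actions true q.dormant)
      (by simp [start, h]), zero_add]
  · rw [epochMatrix_eq_zero_of_better_ne E (q := start E q.actions false q.dormant)
      (by simp [start, h]), add_zero]

theorem transition_nonneg (E : G.Equilibrium) (q q' : G.State) : 0 ≤ transition E q q' :=
  mul_nonneg (by norm_num) measureReal_nonneg

theorem sum_transition (E : G.Equilibrium) (q : G.State) : ∑ q', transition E q q' = 1 := by
  have h : ∀ q', transition E q q' = ∑ r, shockMatrix E q r * epochMatrix E r q' := fun q' =>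
    congrFun (congrFun (of_transition E) q) q'
  simp only [h]
  rw [Finset.sum_comm]
  simp only [← Finset.mul_sum, sum_epochMatrix, mul_one]
  exact sum_stepProb E .shock q

/-- The law of the state at the `k`-th payoff shock is the law of the chain after `k` steps from
the state with Action 0 everywhere and all weak links dormant, whatever the better action. -/
theorem lawReal_atShock (E : G.Equilibrium) (k : ℕ) (q' : G.State) :
    G.law.real {ω | atShock E (k + 1) ω = q'} =
      ((.of (transition E) : Matrix G.State G.State ℝ) ^ (k + 1))
        ⟨fun _ => false, false, Finset.univ⟩ q' := by
  set q₀ : G.State := ⟨fun _ => false, false, Finset.univ⟩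
  have hmeas : MeasurableSet {ω : G.Sample | atShock E (k + 1) ω = q'} :=
    measurable_atShock E (k + 1) (measurableSet_singleton q')
  have e : ∀ R, G.law.real ({ω : G.Sample | atShock E (k + 1) ω = q'} ∩ {ω | ω.2.1 0 = R}) =
      coinMatrix E (k + 1) R (start E (fun _ => false) R Finset.univ) q' := by
    intro R
    change _ = G.law.real _
    congr 1
    ext ω
    refine and_comm.trans (and_congr_right fun hR => ?_)
    change atShock E (k + 1) ω = q' ↔ _
    rw [atShock, initial, show ω.2.1 0 = R from hR]
    rfl
  rw [← sum_lawReal_inter_fiber (f := fun ω : G.Sample => ω.2.1 0) (by fun_prop) hmeas,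
    Fintype.sum_bool, e, e, coinMatrix_succ, coinMatrix_succ, of_transition, pow_succ',
    Matrix.mul_assoc, Matrix.mul_apply]
  refine Eq.trans ?_ (sum_stepProb_shock_mul E q₀ fun r =>
    (epochMatrix E * (shockMatrix E * epochMatrix E) ^ k) r q').symm
  simp only [Matrix.smul_apply, smul_eq_mul, q₀]
  ring

/-! ### Reaching consensus -/

/-- The state in which Action 1 is better, all agents play it, and all weak links are dormant. -/
def consensus (G : Society n) : G.State := ⟨fun _ => true, true, Finset.univ⟩

theorem stepProb_recovery_pos (E : G.Equilibrium) (e : G.Link) (q : G.State) :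
    0 < stepProb E (.recovery e) q { q with dormant := insert e q.dormant } := by
  have : {ω : G.Sample | react E ω (.recovery e) 0 q =
      { q with dormant := insert e q.dormant }} = Set.univ := Set.eq_univ_of_forall fun _ => rfl
  rw [stepProb, this, probReal_univ]
  exact one_pos

theorem stepProb_tremble_pos (E : G.Equilibrium) (i : Fin n) (q : G.State) :
    0 < stepProb E .tremble q { q with
      actions := E.respond q.better q.actions (insert i (G.strong.neighborSet i)) } := by
  have h : MeasurePreserving (fun ω : G.Sample => ω.2.2.1 0) G.law
      (PMF.uniformOfFintype (Fin n)).toMeasure :=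
    (measurePreserving_eval_infinitePi
      (fun _ : ℕ => (PMF.uniformOfFintype (Fin n)).toMeasure) 0).comp
      (measurePreserving_fst.comp (measurePreserving_snd.comp measurePreserving_snd))
  have h1 := h.measureReal_preimage (s := {i}) (by measurability)
  rw [measureReal_def (μ := (PMF.uniformOfFintype (Fin n)).toMeasure),
    PMF.toMeasure_apply_singleton _ _ (measurableSet_singleton i)] at h1
  have h2 : 0 < G.law.real ((fun ω : G.Sample => ω.2.2.1 0) ⁻¹' {i}) := by
    rw [h1]
    simp [NeZero.pos n]
  refine h2.trans_le (measureReal_mono fun ω hω => ?_)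
  change react E ω .tremble 0 q = _
  rw [react, show ω.2.2.1 0 = i from hω]

theorem epochMatrix_consensus_of_actions (E : G.Equilibrium) (B : Finset G.Link) :
    0 < epochMatrix E ⟨fun _ => true, true, B⟩ G.consensus := by
  -- `S` contains the links whose clocks have yet to tick; all others are dormant.
  suffices H : ∀ S : Finset G.Link, ∀ B : Finset G.Link, Sᶜ ⊆ B →
      0 < epochMatrix E ⟨fun _ => true, true, B⟩ G.consensus from H Finset.univ B (by simp)
  intro S
  induction S using Finset.induction_on with
  | empty =>
    intro B hB
    rw [Finset.compl_empty, Finset.univ_subset_iff] at hB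
    subst hB
    exact epochMatrix_self_pos E _
  | insert e S _ ih =>
    intro B hB
    refine epochMatrix_pos_of_step E (by simp) (stepProb_recovery_pos E e _)
      (ih (insert e B) fun f hf => ?_)
    by_cases hfe : f = e
    · simp [hfe]
    · refine Finset.mem_insert_of_mem (hB ?_)
      simpa [hfe] using hf

theorem epochMatrix_consensus_pos (hτ : ∀ i, G.tau * G.degree i < 1) (E : G.Equilibrium)
    (q : G.State) (hq : q.better = true) : 0 < epochMatrix E q G.consensus := by
  -- `S` contains the agents that have yet to tremble; all others play Action 1 for good.
  suffices H : ∀ S : Finset (Fin n), ∀ q : G.State, q.better = true →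
      (∀ i ∉ S, q.actions i = true) → 0 < epochMatrix E q G.consensus from
    H Finset.univ q hq (by simp)
  intro S
  induction S using Finset.induction_on with
  | empty =>
    intro q hq hS
    have : q = ⟨fun _ => true, true, q.dormant⟩ :=
      State.ext (funext fun i => hS i (Finset.notMem_empty i)) hq rfl
    rw [this]
    exact epochMatrix_consensus_of_actions E _
  | insert i S _ ih =>
    intro q hq hS
    refine epochMatrix_pos_of_step E (by simp) (stepProb_tremble_pos E i q) (ih _ hq fun j hj => ?_)
    simp only [hq]
    refine respond_eq_better hτ E true _ _ j ?_
    by_cases hji : j = i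
    · exact .inl (.inl hji)
    · exact .inr (hS j (by simp [hji, hj]))

theorem transition_consensus_pos (hτ : ∀ i, G.tau * G.degree i < 1) (E : G.Equilibrium)
    (q : G.State) : 0 < transition E q G.consensus := by
  rw [transition_eq]
  exact mul_pos (by norm_num) (epochMatrix_consensus_pos hτ E _ rfl)

/-! ### Convergence -/

theorem exists_tendsto_lawReal_atShock (E : G.Equilibrium) (q' : G.State) :
    ∃ l, Tendsto (fun k => G.law.real {ω | atShock E k ω = q'}) atTop (𝓝 l) := by
  have hclosed : ∀ ω : G.Sample, ∀ c ≠ Clock.shock, ∀ q ∈ equilibriumStates E,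
      react E ω c 0 q ∈ equilibriumStates E := fun ω c _ q hq =>
    react_mem_equilibriumStates E ω c 0 hq
  have hzero : ∀ q, ∀ q' ∉ equilibriumStates E, transition E q q' = 0 := fun q q' hq' => by
    rw [transition_eq, epochMatrix_eq_zero E hclosed (start_mem_equilibriumStates E _ _ _) hq',
      mul_zero]
  have hdiag : ∀ q ∈ equilibriumStates E, 0 < transition E q q := by
    intro q hq
    have : start E q.actions q.better q.dormant = q := State.ext hq rfl rfl
    rw [transition_eq, this]
    exact mul_pos (by norm_num) (epochMatrix_self_pos E q)
  set M : Matrix G.State G.State ℝ := .of (transition E) with hM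
  set q₀ : G.State := ⟨fun _ => false, false, Finset.univ⟩ with hq₀
  have hlim : ∀ q, ∃ l, Tendsto (fun k => M q₀ q * (M ^ k) q q') atTop (𝓝 l) := by
    intro q
    by_cases hq : q ∈ equilibriumStates E
    · obtain ⟨l, hl⟩ := exists_tendsto_pow_of_closed (M := M) (transition_nonneg E)
        (sum_transition E) (equilibriumStates E) (fun a _ => hzero a) hdiag hq q'
      exact ⟨_, hl.const_mul _⟩
    · refine ⟨0, ?_⟩
      simp only [show M q₀ q = 0 from hzero q₀ q hq, zero_mul]
      exact tendsto_const_nhds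
  choose l hl using hlim
  refine ⟨∑ q, l q, (tendsto_add_atTop_iff_nat 1).1 ?_⟩
  simp only [lawReal_atShock, pow_succ', Matrix.mul_apply]
  exact tendsto_finsetSum _ fun q _ => hl q

theorem integrable_welfare_summand (E : G.Equilibrium) (k : ℕ) (q : G.State) :
    Integrable (Set.indicator {ω | atShock E k ω = q} fun _ => q.fraction) G.law :=
  (integrable_const _).indicator (measurable_atShock E k (measurableSet_singleton q))

theorem integrable_welfare (E : G.Equilibrium) (k : ℕ) : Integrable (welfare E k) G.law := by
  rw [welfare_eq_sum]
  exact integrable_finsetSum _ fun q _ => integrable_welfare_summand E k q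

theorem integral_welfare (E : G.Equilibrium) (k : ℕ) :
    ∫ ω, welfare E k ω ∂G.law = ∑ q, G.law.real {ω | atShock E k ω = q} * q.fraction := by
  rw [welfare_eq_sum, integral_finsetSum _ fun q _ => integrable_welfare_summand E k q]
  refine Finset.sum_congr rfl fun q _ => ?_
  exact integral_indicator_const _ (measurable_atShock E k (measurableSet_singleton q))

end

end Society

end WeakLinks

end

theorem theorem2 {n : ℕ} [NeZero n] (G : WeakLinks.Society n) (hG : G.graph.Connected)
    (E : G.Equilibrium) :
    ∃ η : G.State → ℝ,
      WeakLinks.Society.IsStationary E η ∧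
      (∀ q, Tendsto (fun k => G.law.real {ω | WeakLinks.Society.atShock E k ω = q})
        atTop (𝓝 (η q))) ∧
      (∀ k, Integrable (WeakLinks.Society.welfare E k) G.law) ∧
      Tendsto (fun k => ∫ ω, WeakLinks.Society.welfare E k ω ∂G.law) atTop
        (𝓝 (∑ q, η q * q.fraction)) ∧
      ((∀ i, G.tau * G.degree i < 1) →
        ∀ η' : G.State → ℝ, WeakLinks.Society.IsStationary E η' → η' = η) := by
  open WeakLinks.Society in
  choose η hη using exists_tendsto_lawReal_atShock (G := G) E
  have hst : WeakLinks.Society.IsStationary E η := by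
    refine ⟨fun q => ge_of_tendsto' (hη q) fun k => measureReal_nonneg, ?_, fun q' => ?_⟩
    · refine tendsto_nhds_unique (tendsto_finsetSum _ fun q _ => hη q) ?_
      simp only [sum_lawReal_fiber (measurable_atShock E _)]
      exact tendsto_const_nhds
    · have h1 := tendsto_finsetSum Finset.univ fun q _ =>
        ((tendsto_add_atTop_iff_nat 1).2 (hη q)).mul_const (transition E q q')
      refine tendsto_nhds_unique h1 (((tendsto_add_atTop_iff_nat 2).2 (hη q')).congr fun k => ?_)
      simp only [lawReal_atShock]
      rw [pow_succ, Matrix.mul_apply]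
      rfl
  refine ⟨η, hst, hη, integrable_welfare E, ?_, fun hτ η' hη' => ?_⟩
  · simp only [integral_welfare]
    exact tendsto_finsetSum _ fun q _ => (hη q).mul_const _
  · exact WeakLinks.stationary_unique (transition_nonneg E) (sum_transition E)
      (transition_consensus_pos hτ E) hη'.2.1 hst.2.1 hη'.2.2 hst.2.2
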